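/- For $0\le k<1$ let $F(u,k)=\int_0^u\frac{dt}{\sqrt{1-k^2\sin^2t}}$ and $E(u,k)=\int_0^u\sqrt{1-k^2\sin^2 t}\,dt$ be the elliptic integrals, $K=K(k)=F(\tfrac\pi2,k)$, $E(k)=E(\tfrac\pi2,k)$; let $\operatorname{am}(\cdot,k)$ be the inverse function of $F(\cdot,k)$, and put $\operatorname{sn}p=\sin\operatorname{am}p$, $\operatorname{cn}p=\cos\operatorname{am}p$, $\operatorname{dn}p=\sqrt{1-k^2\operatorname{sn}^2p}$, $\operatorname{E}(p)=E(\operatorname{am}p,k)$ (all with modulus $k$). Define $$g_1(p,k)=(1-k^2+k^2\operatorname{cn}^4p)(2\operatorname{E}(p)-p)+\operatorname{cn}p\,\operatorname{sn}p\,\operatorname{dn}p\,(2k^2\operatorname{sn}^2p-1),$$ $$h_1(u,k)=(1-k^2+k^2\cos^4u)(2E(u,k)-F(u,k))+\cos u\,\sin u\sqrt{1-k^2\sin^2u}\,(2k^2\sin^2u-1),$$ so that $g_1(F(u,k),k)=h_1(u,k)$ for $0\le k<1$, and $$a_1(u,k)=8-10k^2+4k^4+4k^2(3-2k^2)\cos2u+2k^2(2k^2-1)\cos^22u.$$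 A normal extremal of Euler's elastic problem is a solution of $\dot\beta=c$, $\dot c=-r\sin\beta$ ($r\ge 0$ constant), $\dot\theta=c$, $\dot x=\cos\theta$, $\dot y=\sin\theta$ with $\theta_0=x_0=y_0=0$ and arbitrary initial covector $(\beta,c,r)=(\beta_0,c_0,r)$. The covector is in $N_1$ if $r>0$ and the energy $\mathcal E=\frac{c^2}2-r\cos\beta$ lies in $(-r,r)$; its modulus is then $k=\sqrt{(\mathcal E+r)/(2r)}\in(0,1)$. For a time $t$ put $p=\sqrt r\,t/2$. **Proposition.** The equation $2E(k)-K(k)=0$ has a unique root $k_0\in[0,1)$, and $k_0\in(\frac1{\sqrt2},1)$. The set of those $k\in(\frac1{\sqrt2},k_0)$ for which $h_1(\pi-u,k)=0$ at some zero $u\in(\frac\pi4,\frac\pi2)$ of $a_1(\cdot,k)$ has a greatest element $k_*$, so that $k_*\in(\frac1{\sqrt2},k_0)$. With these numbers: 1. The set $\gamma_{g_1}=\{(p,k)\mid k\in(0,1),\ p\in(0,2K(k)),\ g_1(p,k)=0\}$ is a nonempty connected smooth curve (an embedded one-dimensional $C^\infty$ submanifold of the plane). 2. $\gamma_{g_1}$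 does not intersect the domain $\{(p,k)\mid k\in(0,k_*),\ p\in(0,2K(k))\}$. 3. For $k\in[k_*,1)$ the function $h_1(\cdot,k)$ has a smallest positive root $u_1(k)$, and the function $p_{g_1}(k)=F(u_1(k),k)$, $k\in[k_*,1)$, is of class $C^\infty$ on $(k_*,1)$ and satisfies $\min\{p>0\mid g_1(p,k)=0\}=p_{g_1}(k)$ for $k\in[k_*,1)$. Moreover, - $k\in[k_*,k_0)\Rightarrow p_{g_1}(k)\in(K,\frac32K)$, - $k=k_0\Rightarrow p_{g_1}(k)=K$, - $k\in(k_0,1)\Rightarrow p_{g_1}(k)\in(\frac12K,K)$. 4. For $k\in[k_*,1)$ and $p=p_{g_1}(k)$ one has $2k^2\operatorname{sn}^2(p,k)-1\in(0,1]$. 5. Consider, for fixed $k\in(0,1)$, the system $$\operatorname{sn}^2\tau=\frac{2k^2\operatorname{sn}^2p-1}{k^2\operatorname{sn}^2p},\qquad g_1(p,k)=0\qquad(\ast)$$ in unknowns $(p,\tau)$, $\tau\in\mathbb R$. If $k\in(0,k_*)$, it has no solutions with $p\in(0,2K(k))$. If $k\in[k_*,1)$, then $p_{g_1}(k)$ is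 the minimal $p\in(0,2K(k))$ for which $(\ast)$ has a solution $(p,\tau)$. In the same way, for every fixed $r>0$: if $k\in(0,k_*)$, then no normal extremal with covector in $N_1$, with this $r$ and with modulus $k$, satisfies $\theta_t=\pi \pmod{2\pi}$, $y_t=0$ at a time $t$ with $p=\sqrt r\,t/2\in(0,2K(k))$; and if $k\in[k_*,1)$, then $p_{g_1}(k)$ is the minimal $p\in(0,2K(k))$ for which some such normal extremal satisfies $\theta_t=\pi\pmod{2\pi}$, $y_t=0$ at $t=2p/\sqrt r$. -/

import Mathlib

open Set Real
open scoped ContDiff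

namespace EulerElastica

/-- Incomplete elliptic integral of the first kind `F(u, k)` (`k` is the modulus). -/
noncomputable def ellF (u k : ℝ) : ℝ :=
  ∫ t in (0 : ℝ)..u, 1 / √(1 - k ^ 2 * sin t ^ 2)

/-- Incomplete elliptic integral of the second kind `E(u, k)`. -/
noncomputable def ellE (u k : ℝ) : ℝ :=
  ∫ t in (0 : ℝ)..u, √(1 - k ^ 2 * sin t ^ 2)

/-- Complete elliptic integral of the first kind `K(k)`. -/
noncomputable def compK (k : ℝ) : ℝ := ellF (π / 2) k

/-- Complete elliptic integral of the second kind `E(k)`. -/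
noncomputable def compE (k : ℝ) : ℝ := ellE (π / 2) k

/-- Jacobi's amplitude `am(p, k)`: the inverse of `u ↦ F(u, k)`, which is an increasing bijection
of the real line when `0 ≤ k < 1`. -/
noncomputable def jacAm (p k : ℝ) : ℝ := Function.invFun (fun u => ellF u k) p

/-- Jacobi's elliptic sine. -/
noncomputable def jacSn (p k : ℝ) : ℝ := sin (jacAm p k)

/-- Jacobi's elliptic cosine. -/
noncomputable def jacCn (p k : ℝ) : ℝ := cos (jacAm p k)

/-- Jacobi's delta amplitude. -/
noncomputable def jacDn (p k : ℝ) : ℝ := √(1 - k ^ 2 * jacSn p k ^ 2)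

/-- Jacobi's epsilon function `E(p) = E(am p, k)`. -/
noncomputable def jacEps (p k : ℝ) : ℝ := ellE (jacAm p k) k

/-- The function `g₁(p, k)`. -/
noncomputable def g₁ (p k : ℝ) : ℝ :=
  (1 - k ^ 2 + k ^ 2 * jacCn p k ^ 4) * (2 * jacEps p k - p)
    + jacCn p k * jacSn p k * jacDn p k * (2 * k ^ 2 * jacSn p k ^ 2 - 1)

/-- The function `h₁(u, k)`, which is `g₁(p, k)` after the substitution `p = F(u, k)`. -/
noncomputable def h₁ (u k : ℝ) : ℝ :=
  (1 - k ^ 2 + k ^ 2 * cos u ^ 4) * (2 * ellE u k - ellF u k)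
    + cos u * sin u * √(1 - k ^ 2 * sin u ^ 2) * (2 * k ^ 2 * sin u ^ 2 - 1)

/-- The function `a₁(u, k)`, a quadratic polynomial in `cos 2u`. -/
noncomputable def a₁ (u k : ℝ) : ℝ :=
  (8 - 10 * k ^ 2 + 4 * k ^ 4) + 4 * k ^ 2 * (3 - 2 * k ^ 2) * cos (2 * u)
    + 2 * k ^ 2 * (2 * k ^ 2 - 1) * cos (2 * u) ^ 2

/-- The zero set of `g₁` in the domain `0 < k < 1`, `0 < p < 2 K(k)` of the `(p, k)`-plane. -/
def γg₁ : Set (ℝ × ℝ) :=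
  {z | z.2 ∈ Ioo (0 : ℝ) 1 ∧ z.1 ∈ Ioo 0 (2 * compK z.2) ∧ g₁ z.1 z.2 = 0}

/-- A smooth curve in the plane, i.e. an embedded one-dimensional `C^∞` submanifold:
near each of its points it is the zero set of a `C^∞` function with nonvanishing differential. -/
def IsSmoothPlaneCurve (S : Set (ℝ × ℝ)) : Prop :=
  ∀ z ∈ S, ∃ U : Set (ℝ × ℝ), IsOpen U ∧ z ∈ U ∧ ∃ f : ℝ × ℝ → ℝ, ContDiffOn ℝ ∞ f U ∧
    (∀ w ∈ U, fderiv ℝ f w ≠ 0) ∧ S ∩ U = {w ∈ U | f w = 0}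

/-- The system `sn² τ = (2 k² sn² p - 1) / (k² sn² p)`, `g₁(p, k) = 0`. -/
def JacobiSystem (k p τ : ℝ) : Prop :=
  jacSn τ k ^ 2 = (2 * k ^ 2 * jacSn p k ^ 2 - 1) / (k ^ 2 * jacSn p k ^ 2) ∧ g₁ p k = 0

/-- A normal extremal of the elastic problem: a solution of the normal Hamiltonian system
in the coordinates `(β, c, r)`, `(θ, x, y)`, with `(θ, x, y) = (0, 0, 0)` at time `0`.
Angles are represented by continuous real lifts. -/
structure IsNormalExtremal (r : ℝ) (β c θ x y : ℝ → ℝ) : Prop where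
  deriv_beta : ∀ t, HasDerivAt β (c t) t
  deriv_c : ∀ t, HasDerivAt c (-r * sin (β t)) t
  deriv_theta : ∀ t, HasDerivAt θ (c t) t
  deriv_x : ∀ t, HasDerivAt x (cos (θ t)) t
  deriv_y : ∀ t, HasDerivAt y (sin (θ t)) t
  theta_zero : θ 0 = 0
  x_zero : x 0 = 0
  y_zero : y 0 = 0

/-- Energy of the generalized pendulum. -/
noncomputable def energy (β c r : ℝ) : ℝ := c ^ 2 / 2 - r * cos β

/-- The domain `N₁` of covectors `(β, c, r)`: oscillations of the pendulum. -/
def N₁ : Set (ℝ × ℝ × ℝ) :=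
  {l | 0 < l.2.2 ∧ energy l.1 l.2.1 l.2.2 ∈ Ioo (-l.2.2) l.2.2}

/-- The elliptic coordinate `k` of a covector `(β, c, r)` in `N₁`. -/
noncomputable def modulus (β c r : ℝ) : ℝ := √((energy β c r + r) / (2 * r))

/-- Some normal extremal with covector in `N₁`, with the given `r` and with modulus `k`, satisfies
`θ_t = π` (in the circle) and `y_t = 0` at the time `t` with `p = √r t / 2`. -/
def ExtremalSystem (r k p : ℝ) : Prop :=
  ∃ β c θ x y : ℝ → ℝ, IsNormalExtremal r β c θ x y ∧ (β 0, c 0, r) ∈ N₁ ∧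
    modulus (β 0) (c 0) r = k ∧ ∃ t : ℝ, p = √r * t / 2 ∧
      (θ t : Real.Angle) = (π : Real.Angle) ∧ y t = 0

end EulerElastica

namespace EulerElastica

/-! Dividing `h₁` by the positive factor 1 - k² + k² cos⁴ u gives `G`, which has the same zeros and
whose u-derivative is free of elliptic integrals: on (0, π) it is a positive function times `a₁`
(`hasDerivAt_G`). Since `a₁` is symmetric about π/2 and strictly decreasing on [0, π/2], the shape
of G(·, k) on [0, π] is known. For k² ≤ 1/2 it increases from 0, so it has no zero in (0, π]. For k²
> 1/2 it increases up to a zero v of `a₁`, decreases on [v, π - v] and increases again; a first root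
must lie on the decreasing piece, and the minimum over [v, π] is at π - v.

In the other variable, G(u, ·) is strictly decreasing when u ∈ [π/2, π] (`strictAntiOn_G`), so the
zeros over this interval form the graph k = κ(u) of a continuous function (`exists_modulus_branch`).
Because G(π, k) = 2 G(π/2, k), κ equals k₀ at both ends, and it is smaller inside. The number k_* is
the minimum of κ: below it G is positive on (0, π], and from it on there is a first root
(`exists_isFirstRoot`), which is simple and hence smooth in k for k > k_*. The bounds K/2 and 3K/2
come from the fact that the amplitude of K/2 is less than v.

A zero of G in (0, π) with vanishing u-derivative lies in (π/2, π), where the k-derivative is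
negative; so the zero set is a submanifold (`fderiv_g₁_ne_zero`). It is the union of the graph of κ
over [π/2, π) and of the first-root branch over [k₀, 1), carried over by p = F(u, k); the two pieces
meet at u = π/2, k = k₀, which gives connectedness.

For extremals, the pendulum is integrated by Jacobi's functions with an initial phase φ. With τ = φ
+ p the addition theorems turn θ_t = π into the first equation of the system and, given that
equation, y_t = 0 into g₁ = 0 (`IsNormalExtremal.theta_eq_pi_and_y_eq_zero_iff`). At the first root
`a₁` ≤ 0, which makes the first equation solvable in τ. -/

open Filter Topology

/-! ### Smooth dependence of a primitive on a parameter -/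

/-- A primitive with a smooth parameter is differentiable; its partial derivatives are the integrand
and the primitive of the partial derivative of the integrand. -/
theorem hasFDerivAt_parametric_primitive {φ : ℝ × ℝ → ℝ} (hφ : ContDiff ℝ 1 φ) (w : ℝ × ℝ) :
    HasFDerivAt (fun w : ℝ × ℝ => ∫ t in (0 : ℝ)..w.1, φ (t, w.2))
      (φ w • ContinuousLinearMap.fst ℝ ℝ ℝ +
        (∫ t in (0 : ℝ)..w.1, fderiv ℝ φ (t, w.2) (0, 1)) • ContinuousLinearMap.snd ℝ ℝ ℝ) w := by
  have hc : Continuous φ := hφ.continuous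
  have hd : Continuous (fun w : ℝ × ℝ => fderiv ℝ φ w (0, 1)) :=
    (hφ.continuous_fderiv one_ne_zero).clm_apply continuous_const
  have hc' : Continuous (Function.uncurry fun (s : ℝ) (t : ℝ) => φ (t, s)) := by
    simp only [Function.uncurry_def]; fun_prop
  have hd' : Continuous (Function.uncurry fun (s : ℝ) (t : ℝ) => fderiv ℝ φ (t, s) (0, 1)) := by
    simp only [Function.uncurry_def]
    exact hd.comp (continuous_snd.prodMk continuous_fst)
  have key := hasStrictFDerivAt_uncurry_coprod (𝕜 := ℝ) (u := w)
    (f := fun u s => ∫ t in (0 : ℝ)..u, φ (t, s))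
    (f₁ := fun u s => ContinuousLinearMap.toSpanSingleton ℝ (φ (u, s)))
    (f₂ := fun u s => ContinuousLinearMap.toSpanSingleton ℝ
      (∫ t in (0 : ℝ)..u, fderiv ℝ φ (t, s) (0, 1)))
    (Eventually.of_forall fun v => ?_) (Eventually.of_forall fun v => ?_) ?_ ?_
  · refine key.hasFDerivAt.congr_fderiv ?_
    ext <;> simp [Function.HasUncurry.uncurry]
  · have : Continuous fun t => φ (t, v.2) := by fun_prop
    exact (intervalIntegral.integral_hasDerivAt_right (this.intervalIntegrable _ _)
      this.stronglyMeasurable.stronglyMeasurableAtFilter this.continuousAt).hasFDerivAt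
  · have hK : IsCompact (uIcc 0 v.1 ×ˢ Metric.closedBall v.2 1) :=
      isCompact_uIcc.prod (isCompact_closedBall _ _)
    obtain ⟨C, hC⟩ := hK.exists_bound_of_continuousOn hd.continuousOn
    have := intervalIntegral.hasDerivAt_integral_of_dominated_loc_of_deriv_le
      (μ := MeasureTheory.volume) (a := 0) (b := v.1)
      (F := fun s t => φ (t, s)) (F' := fun s t => fderiv ℝ φ (t, s) (0, 1)) (x₀ := v.2)
      (s := Metric.closedBall v.2 1) (bound := fun _ => C)
      (Metric.closedBall_mem_nhds _ one_pos)
      (Eventually.of_forall fun s => ?_) ?_ ?_ ?_ ?_ ?_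
    · exact this.2.hasFDerivAt
    · exact (Continuous.aestronglyMeasurable (by fun_prop))
    · exact Continuous.intervalIntegrable (by fun_prop) _ _
    · exact (hd'.uncurry_left v.2).aestronglyMeasurable
    · exact Eventually.of_forall fun t ht s hs => hC (t, s) ⟨uIoc_subset_uIcc ht, hs⟩
    · simp
    · refine Eventually.of_forall fun t _ s _ => ?_
      have h1 : HasFDerivAt φ (fderiv ℝ φ (t, s)) (t, s) :=
        (hφ.differentiable one_ne_zero).differentiableAt.hasFDerivAt
      exact h1.comp_hasDerivAt s ((hasDerivAt_const s t).prodMk (hasDerivAt_id s))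
  · have : Continuous fun w : ℝ × ℝ => ContinuousLinearMap.toSpanSingleton ℝ (φ w) :=
      (ContinuousLinearMap.toSpanSingletonCLE (𝕜 := ℝ) (E := ℝ)).continuous.comp hc
    exact this.continuousAt
  · have h2 : Continuous fun w : ℝ × ℝ => ∫ t in (0 : ℝ)..w.1, fderiv ℝ φ (t, w.2) (0, 1) :=
      (intervalIntegral.continuous_parametric_primitive_of_continuous
        (μ := MeasureTheory.volume) (a₀ := 0) hd').comp (continuous_snd.prodMk continuous_fst)
    have : Continuous fun w : ℝ × ℝ => ContinuousLinearMap.toSpanSingleton ℝ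
        (∫ t in (0 : ℝ)..w.1, fderiv ℝ φ (t, w.2) (0, 1)) :=
      (ContinuousLinearMap.toSpanSingletonCLE (𝕜 := ℝ) (E := ℝ)).continuous.comp h2
    exact this.continuousAt

/-- A primitive of a `C^n` function with a parameter is `C^n`, jointly in the upper limit and the
parameter. -/
theorem contDiff_parametric_primitive (n : ℕ) : ∀ {φ : ℝ × ℝ → ℝ}, ContDiff ℝ n φ →
    ContDiff ℝ n fun w : ℝ × ℝ => ∫ t in (0 : ℝ)..w.1, φ (t, w.2) := by
  induction n with
  | zero =>
    intro φ hφ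
    have hc : Continuous φ := hφ.continuous
    have hc' : Continuous (Function.uncurry fun (s : ℝ) (t : ℝ) => φ (t, s)) := by
      simp only [Function.uncurry_def]; fun_prop
    exact contDiff_zero.2 ((intervalIntegral.continuous_parametric_primitive_of_continuous
        (μ := MeasureTheory.volume) (a₀ := 0) hc').comp (continuous_snd.prodMk continuous_fst))
  | succ n ih =>
    intro φ hφ
    push_cast at hφ ⊢
    rw [contDiff_succ_iff_hasFDerivAt]
    -- The differential is built from φ and the primitive of its parameter derivative; the latter is
    -- of the same type with one derivative fewer, so the induction closes.
    refine ⟨_, ?_, hasFDerivAt_parametric_primitive (hφ.of_le (by simp))⟩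
    have hd : ContDiff ℝ n (fun w : ℝ × ℝ => fderiv ℝ φ w (0, 1)) :=
      (hφ.fderiv_right le_rfl).clm_apply contDiff_const
    exact ((hφ.of_le (by simp)).smul contDiff_const).add ((ih hd).smul contDiff_const)

theorem contDiff_infty_parametric_primitive {φ : ℝ × ℝ → ℝ} (hφ : ContDiff ℝ ∞ φ) :
    ContDiff ℝ ∞ fun w : ℝ × ℝ => ∫ t in (0 : ℝ)..w.1, φ (t, w.2) :=
  contDiff_infty.2 fun n => contDiff_parametric_primitive n (contDiff_infty.1 hφ n)

/-! ### Elliptic integrals -/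

theorem one_sub_pos {k : ℝ} (hk : k ^ 2 < 1) (t : ℝ) : 0 < 1 - k ^ 2 * sin t ^ 2 := by
  nlinarith [sin_sq_le_one t, sq_nonneg (sin t), sq_nonneg k]

theorem continuous_delta (k : ℝ) : Continuous fun t => √(1 - k ^ 2 * sin t ^ 2) := by fun_prop

theorem delta_pos {k : ℝ} (hk : k ^ 2 < 1) (t : ℝ) : 0 < √(1 - k ^ 2 * sin t ^ 2) :=
  sqrt_pos.2 (one_sub_pos hk t)

theorem delta_sq {k : ℝ} (hk : k ^ 2 < 1) (t : ℝ) :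
    √(1 - k ^ 2 * sin t ^ 2) ^ 2 = 1 - k ^ 2 * sin t ^ 2 :=
  sq_sqrt (one_sub_pos hk t).le

theorem continuous_inv_delta {k : ℝ} (hk : k ^ 2 < 1) :
    Continuous fun t => 1 / √(1 - k ^ 2 * sin t ^ 2) :=
  continuous_const.div (continuous_delta k) fun t => (delta_pos hk t).ne'

theorem hasDerivAt_ellF {k : ℝ} (hk : k ^ 2 < 1) (u : ℝ) :
    HasDerivAt (fun u => ellF u k) (1 / √(1 - k ^ 2 * sin u ^ 2)) u :=
  (continuous_inv_delta hk).integral_hasStrictDerivAt 0 u |>.hasDerivAt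

theorem hasDerivAt_ellE (k u : ℝ) :
    HasDerivAt (fun u => ellE u k) (√(1 - k ^ 2 * sin u ^ 2)) u :=
  (continuous_delta k).integral_hasStrictDerivAt 0 u |>.hasDerivAt

@[simp] theorem ellF_zero (k : ℝ) : ellF 0 k = 0 := by simp [ellF]

@[simp] theorem ellE_zero (k : ℝ) : ellE 0 k = 0 := by simp [ellE]

theorem strictMono_ellF {k : ℝ} (hk : k ^ 2 < 1) : StrictMono fun u => ellF u k :=
  strictMono_of_hasDerivAt_pos (hasDerivAt_ellF hk) fun u => one_div_pos.2 (delta_pos hk u)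

theorem continuous_ellF {k : ℝ} (hk : k ^ 2 < 1) : Continuous fun u => ellF u k :=
  continuous_iff_continuousAt.2 fun u => (hasDerivAt_ellF hk u).continuousAt

theorem monotone_ellF_sub_id {k : ℝ} (hk : k ^ 2 < 1) : Monotone fun u => ellF u k - u := by
  refine monotone_of_hasDerivAt_nonneg (fun u => (hasDerivAt_ellF hk u).sub (hasDerivAt_id u))
    fun u => ?_
  have h1 : √(1 - k ^ 2 * sin u ^ 2) ≤ 1 := by
    exact sqrt_le_one.2 (by nlinarith [mul_nonneg (sq_nonneg k) (sq_nonneg (sin u))])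
  have := (one_le_div (delta_pos hk u)).2 h1
  simp only [Pi.zero_apply]; linarith

theorem surjective_ellF {k : ℝ} (hk : k ^ 2 < 1) : Function.Surjective fun u => ellF u k := by
  refine (continuous_ellF hk).surjective ?_ ?_
  · refine tendsto_atTop_mono' _ ?_ tendsto_id
    filter_upwards [eventually_ge_atTop 0] with u hu
    simpa using monotone_ellF_sub_id hk hu
  · refine tendsto_atBot_mono' _ ?_ tendsto_id
    filter_upwards [eventually_le_atBot 0] with u hu
    simpa using monotone_ellF_sub_id hk hu

theorem ellF_jacAm {k : ℝ} (hk : k ^ 2 < 1) (p : ℝ) : ellF (jacAm p k) k = p :=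
  Function.rightInverse_invFun (surjective_ellF hk) p

theorem jacAm_ellF {k : ℝ} (hk : k ^ 2 < 1) (u : ℝ) : jacAm (ellF u k) k = u :=
  Function.leftInverse_invFun (strictMono_ellF hk).injective u

theorem ellF_pi_sub {k : ℝ} (hk : k ^ 2 < 1) (u : ℝ) :
    ellF (π - u) k = 2 * compK k - ellF u k := by
  have h : ∀ x, HasDerivAt (fun u => ellF (π - u) k + ellF u k) 0 x := fun x => by
    have h1 := ((hasDerivAt_ellF hk (π - x)).comp x ((hasDerivAt_id x).const_sub π)).add
      (hasDerivAt_ellF hk x)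
    refine h1.congr_deriv ?_
    rw [sin_pi_sub]; ring
  have := is_const_of_deriv_eq_zero (fun x => (h x).differentiableAt) (fun x => (h x).deriv)
    u (π / 2)
  simp only [show π - π / 2 = π / 2 by ring] at this
  rw [compK]; linarith

theorem ellE_pi_sub (k u : ℝ) : ellE (π - u) k = 2 * compE k - ellE u k := by
  have h : ∀ x, HasDerivAt (fun u => ellE (π - u) k + ellE u k) 0 x := fun x => by
    have h1 := ((hasDerivAt_ellE k (π - x)).comp x ((hasDerivAt_id x).const_sub π)).add
      (hasDerivAt_ellE k x)
    refine h1.congr_deriv ?_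
    rw [sin_pi_sub]; ring
  have := is_const_of_deriv_eq_zero (fun x => (h x).differentiableAt) (fun x => (h x).deriv)
    u (π / 2)
  simp only [show π - π / 2 = π / 2 by ring] at this
  rw [compE]; linarith

theorem ellF_pi {k : ℝ} (hk : k ^ 2 < 1) : ellF π k = 2 * compK k := by
  simpa using ellF_pi_sub hk 0

theorem ellE_pi (k : ℝ) : ellE π k = 2 * compE k := by
  simpa using ellE_pi_sub k 0

/-- The root √(1 + m² cos² t), m = k/√(1 - k²), is smooth for every real m, whereas the original one
is smooth only for k² < 1. This lets the theorem on globally smooth integrands apply to F and E. -/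
theorem delta_eq {k : ℝ} (hk : k ^ 2 < 1) (t : ℝ) :
    √(1 - k ^ 2 * sin t ^ 2) = √(1 - k ^ 2) * √(1 + (k / √(1 - k ^ 2)) ^ 2 * cos t ^ 2) := by
  have h0 : 0 < 1 - k ^ 2 := by linarith
  rw [← sqrt_mul h0.le, div_pow, sq_sqrt h0.le]
  congr 1
  field_simp
  rw [sin_sq]; ring

theorem contDiffAt_modulus_subst {w : ℝ × ℝ} (hk : w.2 ^ 2 < 1) :
    ContDiffAt ℝ ∞ (fun w : ℝ × ℝ => (w.1, w.2 / √(1 - w.2 ^ 2))) w := by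
  have h0 : 0 < 1 - w.2 ^ 2 := by linarith
  have h1 : ContDiffAt ℝ ∞ (fun w : ℝ × ℝ => √(1 - w.2 ^ 2)) w :=
    ContDiffAt.sqrt (by fun_prop) h0.ne'
  exact contDiffAt_fst.prodMk (contDiffAt_snd.div h1 (sqrt_pos.2 h0).ne')

theorem eventually_sq_lt_one {w : ℝ × ℝ} (hk : w.2 ^ 2 < 1) : ∀ᶠ v in 𝓝 w, v.2 ^ 2 < 1 :=
  (continuous_snd.pow 2).continuousAt.eventually_lt continuousAt_const hk

theorem contDiff_one_add (n : ℕ∞ω) :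
    ContDiff ℝ n fun w : ℝ × ℝ => √(1 + w.2 ^ 2 * cos w.1 ^ 2) :=
  ContDiff.sqrt (contDiff_const.add ((contDiff_snd.pow 2).mul ((contDiff_cos.comp contDiff_fst).pow 2)))
    fun w => by positivity

theorem contDiffAt_ellF {w : ℝ × ℝ} (hk : w.2 ^ 2 < 1) :
    ContDiffAt ℝ ∞ (fun w : ℝ × ℝ => ellF w.1 w.2) w := by
  have h0 : 0 < 1 - w.2 ^ 2 := by linarith
  have h1 : ContDiff ℝ ∞ fun w : ℝ × ℝ => ∫ t in (0 : ℝ)..w.1, 1 / √(1 + w.2 ^ 2 * cos t ^ 2) :=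
    contDiff_infty_parametric_primitive (φ := fun w => 1 / √(1 + w.2 ^ 2 * cos w.1 ^ 2))
      (contDiff_const.div (contDiff_one_add _) fun w => by positivity)
  have h2 : ContDiffAt ℝ ∞ (fun w : ℝ × ℝ => √(1 - w.2 ^ 2)) w :=
    ContDiffAt.sqrt (by fun_prop) h0.ne'
  have h3 := (contDiffAt_const (c := (1 : ℝ))).div h2 (sqrt_pos.2 h0).ne' |>.mul
    (h1.contDiffAt.comp w (contDiffAt_modulus_subst hk))
  refine h3.congr_of_eventuallyEq ?_
  filter_upwards [eventually_sq_lt_one hk] with v hv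
  simp only [ellF, Function.comp, Pi.div_apply]
  rw [← intervalIntegral.integral_const_mul]
  refine intervalIntegral.integral_congr fun t _ => ?_
  simp only [delta_eq hv]
  rw [one_div_mul_one_div]

theorem contDiffAt_ellE {w : ℝ × ℝ} (hk : w.2 ^ 2 < 1) :
    ContDiffAt ℝ ∞ (fun w : ℝ × ℝ => ellE w.1 w.2) w := by
  have h0 : 0 < 1 - w.2 ^ 2 := by linarith
  have h1 : ContDiff ℝ ∞ fun w : ℝ × ℝ => ∫ t in (0 : ℝ)..w.1, √(1 + w.2 ^ 2 * cos t ^ 2) :=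
    contDiff_infty_parametric_primitive (φ := fun w => √(1 + w.2 ^ 2 * cos w.1 ^ 2))
      (contDiff_one_add _)
  have h2 : ContDiffAt ℝ ∞ (fun w : ℝ × ℝ => √(1 - w.2 ^ 2)) w :=
    ContDiffAt.sqrt (by fun_prop) h0.ne'
  have h3 := h2.mul (h1.contDiffAt.comp w (contDiffAt_modulus_subst hk))
  refine h3.congr_of_eventuallyEq ?_
  filter_upwards [eventually_sq_lt_one hk] with v hv
  simp only [ellE, Function.comp]
  rw [← intervalIntegral.integral_const_mul]
  refine intervalIntegral.integral_congr fun t _ => ?_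
  simp only [delta_eq hv]

/-! ### The normalized function `h₁ / (1 - k² + k² cos⁴ u)` -/

/-- The factor `√(1 - κ z) (2 κ z - 1) / (1 - 2 κ z + κ z²)`, where `κ = k²` and `z = sin² u`. -/
noncomputable def rho (κ z : ℝ) : ℝ := √(1 - κ * z) * (2 * κ * z - 1) / (1 - 2 * κ * z + κ * z ^ 2)

/-- The quotient of `h₁(u, k)` by the positive function `1 - k² + k² cos⁴ u`. -/
noncomputable def G (u k : ℝ) : ℝ :=
  2 * ellE u k - ellF u k + cos u * sin u * rho (k ^ 2) (sin u ^ 2)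

theorem denom_pos {κ z : ℝ} (h0 : 0 ≤ κ) (h1 : κ < 1) : 0 < 1 - 2 * κ * z + κ * z ^ 2 := by
  nlinarith [mul_nonneg h0 (sq_nonneg (1 - z))]

theorem denom_eq (u k : ℝ) :
    1 - k ^ 2 + k ^ 2 * cos u ^ 4 = 1 - 2 * k ^ 2 * sin u ^ 2 + k ^ 2 * (sin u ^ 2) ^ 2 := by
  rw [show cos u ^ 4 = (cos u ^ 2) ^ 2 by ring, cos_sq']; ring

theorem h₁_eq {k : ℝ} (hk : k ^ 2 < 1) (u : ℝ) :
    h₁ u k = (1 - 2 * k ^ 2 * sin u ^ 2 + k ^ 2 * (sin u ^ 2) ^ 2) * G u k := by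
  have := (denom_pos (z := sin u ^ 2) (sq_nonneg k) hk).ne'
  rw [h₁, denom_eq, G, rho, mul_add, mul_left_comm _ (cos u * sin u), mul_div_cancel₀ _ this]
  ring

theorem h₁_eq_zero_iff {k : ℝ} (hk : k ^ 2 < 1) (u : ℝ) : h₁ u k = 0 ↔ G u k = 0 := by
  rw [h₁_eq hk, mul_eq_zero, or_iff_right (denom_pos (sq_nonneg k) hk).ne']

theorem g₁_eq {k : ℝ} (hk : k ^ 2 < 1) (p : ℝ) : g₁ p k = h₁ (jacAm p k) k := by
  rw [g₁, h₁, ellF_jacAm hk]; rfl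

theorem hasDerivAt_sin_sq (u : ℝ) : HasDerivAt (fun u => sin u ^ 2) (2 * sin u * cos u) u := by
  simpa using (hasDerivAt_sin u).fun_pow 2

theorem hasDerivAt_delta {k : ℝ} (hk : k ^ 2 < 1) (u : ℝ) :
    HasDerivAt (fun u => √(1 - k ^ 2 * sin u ^ 2))
      (-(k ^ 2 * sin u * cos u) / √(1 - k ^ 2 * sin u ^ 2)) u := by
  have h := (((hasDerivAt_sin_sq u).const_mul (k ^ 2)).const_sub 1).sqrt (one_sub_pos hk u).ne'
  refine h.congr_deriv ?_
  have := (delta_pos hk u).ne'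
  field_simp

/-- This computation is the reason for dividing by f: the integrals enter `G` with constant
coefficients, so the derivative is algebraic in s, c, D, and its numerator factors through `a₁`. -/
theorem G_deriv_identity {k s c D f a : ℝ} (hD0 : D ≠ 0) (hf0 : f ≠ 0)
    (hD : D ^ 2 = 1 - k ^ 2 * s ^ 2) (hc : c ^ 2 = 1 - s ^ 2)
    (hf : f = 1 - 2 * k ^ 2 * s ^ 2 + k ^ 2 * (s ^ 2) ^ 2)
    (ha : a = (8 - 10 * k ^ 2 + 4 * k ^ 4) + 4 * k ^ 2 * (3 - 2 * k ^ 2) * (1 - 2 * s ^ 2)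
      + 2 * k ^ 2 * (2 * k ^ 2 - 1) * (1 - 2 * s ^ 2) ^ 2) :
    2 * D - 1 / D + ((-s * s + c * c) * (D * (2 * k ^ 2 * s ^ 2 - 1) / f) +
      c * s * (((-(k ^ 2 * s * c) / D * (2 * k ^ 2 * s ^ 2 - 1) + D * (2 * k ^ 2 * (2 * s * c))) * f -
        D * (2 * k ^ 2 * s ^ 2 - 1) * (-(2 * k ^ 2 * (2 * s * c)) +
          k ^ 2 * (2 * s ^ 2 * (2 * s * c)))) / f ^ 2)) =
    s ^ 2 * a * D / (4 * f ^ 2) := by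
  field_simp
  rw [hf, ha]
  ring_nf
  simp only [hD, hc]
  ring

theorem a₁_eq (u k : ℝ) : a₁ u k =
    (8 - 10 * k ^ 2 + 4 * k ^ 4) + 4 * k ^ 2 * (3 - 2 * k ^ 2) * (1 - 2 * sin u ^ 2)
      + 2 * k ^ 2 * (2 * k ^ 2 - 1) * (1 - 2 * sin u ^ 2) ^ 2 := by
  rw [a₁, cos_two_mul, cos_sq']; ring

theorem hasDerivAt_G {k : ℝ} (hk : k ^ 2 < 1) (u : ℝ) :
    HasDerivAt (fun u => G u k) (sin u ^ 2 * a₁ u k * √(1 - k ^ 2 * sin u ^ 2) /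
      (4 * (1 - 2 * k ^ 2 * sin u ^ 2 + k ^ 2 * (sin u ^ 2) ^ 2) ^ 2)) u := by
  have hf := (denom_pos (z := sin u ^ 2) (sq_nonneg k) hk).ne'
  have hs := hasDerivAt_sin_sq u
  have h := (((hasDerivAt_ellE k u).const_mul 2).fun_sub (hasDerivAt_ellF hk u)).fun_add
    (((hasDerivAt_cos u).fun_mul (hasDerivAt_sin u)).fun_mul
      (((hasDerivAt_delta hk u).fun_mul ((hs.const_mul (2 * k ^ 2)).sub_const 1)).fun_div
        (((hs.const_mul (2 * k ^ 2)).const_sub 1).fun_add ((hs.fun_pow 2).const_mul (k ^ 2))) hf))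
  refine h.congr_deriv ?_
  rw [← G_deriv_identity (delta_pos hk u).ne' hf (delta_sq hk u) (cos_sq' u) rfl (a₁_eq u k)]
  simp

/-! ### Dependence on the modulus -/

/-- Expand about κ = 1: the value there is (1 - z)(1 - z + 2z²) ≥ 0, and the difference is 1 - κ
times a factor bounded below by z(4 - 7z + 4z²), a quadratic of negative discriminant times z. -/
theorem rho_numerator_pos {κ z : ℝ} (h1 : κ < 1) (hz0 : 0 < z) (hz1 : z ≤ 1) :
    0 < 1 + 2 * z - (4 * z + z ^ 2) * κ + (4 * z ^ 2 - 2 * z ^ 3) * κ ^ 2 := by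
  have h2 : 0 ≤ (1 - z) * (1 - z + 2 * z ^ 2) := mul_nonneg (by linarith) (by nlinarith)
  have h4 : 0 < z * (4 - 7 * z + 4 * z ^ 2) := mul_pos hz0 (by nlinarith [sq_nonneg (8 * z - 7)])
  have h5 : 0 ≤ (4 * z ^ 2 - 2 * z ^ 3) := by nlinarith [sq_nonneg z]
  have h3 : 0 < (1 - κ) * ((4 * z + z ^ 2) - (4 * z ^ 2 - 2 * z ^ 3) * (1 + κ)) := by
    refine mul_pos (by linarith) ?_
    nlinarith [mul_nonneg h5 (sub_nonneg.2 h1.le)]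
  nlinarith

theorem hasDerivAt_rho {κ z : ℝ} (h0 : 0 ≤ κ) (h1 : κ < 1) (hz0 : 0 < z) (hz1 : z ≤ 1) :
    HasDerivAt (fun κ => rho κ z)
      (z * (1 + 2 * z - (4 * z + z ^ 2) * κ + (4 * z ^ 2 - 2 * z ^ 3) * κ ^ 2) /
        (2 * √(1 - κ * z) * (1 - 2 * κ * z + κ * z ^ 2) ^ 2)) κ := by
  have hp : 0 < 1 - κ * z := by nlinarith
  have hf := (denom_pos (z := z) h0 h1).ne'
  have hid := hasDerivAt_id' κ
  have h := ((((hid.mul_const z).const_sub 1).sqrt hp.ne').fun_mul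
    (((hid.const_mul 2).mul_const z).sub_const 1)).fun_div
    ((((hid.const_mul 2).mul_const z).const_sub 1).fun_add (hid.mul_const (z ^ 2))) hf
  refine h.congr_deriv ?_
  have hD0 := (sqrt_pos.2 hp).ne'
  have hD := sq_sqrt hp.le
  generalize hfe : 1 - 2 * κ * z + κ * z ^ 2 = f at *
  generalize √(1 - κ * z) = D at *
  field_simp
  rw [hD, ← hfe]
  ring

theorem rho_deriv_pos {κ z : ℝ} (h0 : 0 ≤ κ) (h1 : κ < 1) (hz0 : 0 < z) (hz1 : z ≤ 1) :
    0 < z * (1 + 2 * z - (4 * z + z ^ 2) * κ + (4 * z ^ 2 - 2 * z ^ 3) * κ ^ 2) /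
        (2 * √(1 - κ * z) * (1 - 2 * κ * z + κ * z ^ 2) ^ 2) := by
  have hp : 0 < 1 - κ * z := by nlinarith
  have hf := denom_pos (z := z) h0 h1
  have := sqrt_pos.2 hp
  have := rho_numerator_pos h1 hz0 hz1
  positivity

theorem strictMonoOn_rho {z : ℝ} (hz0 : 0 < z) (hz1 : z ≤ 1) :
    StrictMonoOn (fun κ => rho κ z) (Ico 0 1) := by
  refine strictMonoOn_of_deriv_pos (convex_Ico 0 1) (fun κ hκ =>
    (hasDerivAt_rho hκ.1 hκ.2 hz0 hz1).continuousAt.continuousWithinAt) fun κ hκ => ?_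
  rw [interior_Ico] at hκ
  rw [(hasDerivAt_rho hκ.1.le hκ.2 hz0 hz1).deriv]
  exact rho_deriv_pos hκ.1.le hκ.2 hz0 hz1

theorem delta_lt_delta {k l t : ℝ} (hk0 : 0 ≤ k) (hkl : k < l) (ht : sin t ≠ 0) (hl : l ^ 2 < 1) :
    √(1 - l ^ 2 * sin t ^ 2) < √(1 - k ^ 2 * sin t ^ 2) := by
  refine sqrt_lt_sqrt (one_sub_pos hl t).le ?_
  have : k ^ 2 < l ^ 2 := by gcongr
  nlinarith [pow_pos (abs_pos.2 ht) 2, sq_abs (sin t)]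

theorem strictAntiOn_two_ellE_sub_ellF {u : ℝ} (hu0 : 0 < u) (hu : u ≤ π) :
    StrictAntiOn (fun k => 2 * ellE u k - ellF u k) (Ico 0 1) := by
  intro k hk l hl hkl
  have hk1 : k ^ 2 < 1 := by nlinarith [hk.1, hk.2]
  have hl1 : l ^ 2 < 1 := by nlinarith [hl.1, hl.2]
  have hE : ellE u l < ellE u k := by
    refine intervalIntegral.integral_lt_integral_of_continuousOn_of_le_of_exists_lt hu0
      (continuous_delta l).continuousOn (continuous_delta k).continuousOn (fun t _ => ?_)
      ⟨u / 2, ⟨by linarith, by linarith⟩, delta_lt_delta hk.1 hkl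
        (sin_pos_of_pos_of_lt_pi (by linarith) (by linarith [pi_pos])).ne' hl1⟩
    rcases eq_or_ne (sin t) 0 with h | h
    · simp [h]
    · exact (delta_lt_delta hk.1 hkl h hl1).le
  have hF : ellF u k ≤ ellF u l := by
    refine intervalIntegral.integral_mono_on hu0.le
      ((continuous_inv_delta hk1).intervalIntegrable _ _)
      ((continuous_inv_delta hl1).intervalIntegrable _ _) fun t _ => ?_
    refine one_div_le_one_div_of_le (delta_pos hl1 t) ?_
    rcases eq_or_ne (sin t) 0 with h | h
    · simp [h]
    · exact (delta_lt_delta hk.1 hkl h hl1).le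
  simp only
  linarith

/-- The integral part decreases because Δ decreases in k. The algebraic part decreases weakly
because `rho` increases and cos u sin u ≤ 0; this sign is what restricts u to [π/2, π]. -/
theorem strictAntiOn_G {u : ℝ} (hu0 : π / 2 ≤ u) (hu : u ≤ π) :
    StrictAntiOn (fun k => G u k) (Ico 0 1) := by
  intro k hk l hl hkl
  have h1 := strictAntiOn_two_ellE_sub_ellF (by linarith [pi_pos]) hu hk hl hkl
  have h2 : cos u * sin u * rho (l ^ 2) (sin u ^ 2) ≤ cos u * sin u * rho (k ^ 2) (sin u ^ 2) := by
    rcases hu.eq_or_lt with rfl | hlt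
    · simp
    · have hs : 0 < sin u := sin_pos_of_pos_of_lt_pi (by linarith [pi_pos]) hlt
      have hc : cos u ≤ 0 := cos_nonpos_of_pi_div_two_le_of_le hu0 (by linarith [pi_pos])
      refine mul_le_mul_of_nonpos_left ?_ (mul_nonpos_of_nonpos_of_nonneg hc hs.le)
      exact (strictMonoOn_rho (pow_pos hs 2) (sin_sq_le_one u)
        ⟨sq_nonneg k, by nlinarith [hk.1, hk.2]⟩ ⟨sq_nonneg l, by nlinarith [hl.1, hl.2]⟩
        (by nlinarith [hk.1])).le
  simp only [G] at h1 ⊢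
  linarith

/-- The partial derivative of `G` in the modulus is negative for `π / 2 < u < π`. -/
theorem G_deriv_modulus_neg {u k g' : ℝ} (hu0 : π / 2 < u) (hu : u < π) (hk : k ∈ Ioo 0 1)
    (h : HasDerivAt (fun k => G u k) g' k) : g' < 0 := by
  have hs : 0 < sin u := sin_pos_of_pos_of_lt_pi (by linarith [pi_pos]) hu
  have hc : cos u < 0 := cos_neg_of_pi_div_two_lt_of_lt hu0 (by linarith [pi_pos])
  have hk2 : k ^ 2 < 1 := by nlinarith [hk.1, hk.2]
  have hr := hasDerivAt_rho (sq_nonneg k) hk2 (pow_pos hs 2) (sin_sq_le_one u)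
  have hpos := rho_deriv_pos (sq_nonneg k) hk2 (pow_pos hs 2) (sin_sq_le_one u)
  have h1 := (HasDerivAt.comp (h := fun k : ℝ => k ^ 2) k hr (hasDerivAt_pow 2 k)).const_mul (cos u * sin u)
  have h2 := h.fun_sub h1
  have h3 : (fun k => G u k - cos u * sin u * ((fun κ => rho κ (sin u ^ 2)) ∘ fun k => k ^ 2) k) =
      fun k => 2 * ellE u k - ellF u k := by
    ext k; simp [G]
  rw [h3] at h2
  -- Strictness comes from the `rho` term alone, so for the integrals a nonpositive derivative
  -- suffices; it follows from monotonicity, without differentiating under the integral.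
  have h4 := (strictAntiOn_two_ellE_sub_ellF (by linarith [pi_pos]) hu.le).antitoneOn
  have h5 := h4.derivWithin_nonpos (x := k)
  rw [(h2.hasDerivWithinAt (s := Ico 0 1)).derivWithin
    (uniqueDiffWithinAt_of_mem_nhds (Ico_mem_nhds hk.1 hk.2))] at h5
  have h6 : cos u * sin u < 0 := mul_neg_of_neg_of_pos hc hs
  have h7 := mul_neg_of_neg_of_pos h6 (mul_pos hpos hk.1)
  simp at h5
  nlinarith

theorem contDiffAt_G {w : ℝ × ℝ} (hk : w.2 ^ 2 < 1) :
    ContDiffAt ℝ ∞ (fun w : ℝ × ℝ => G w.1 w.2) w := by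
  have hs : ContDiffAt ℝ ∞ (fun w : ℝ × ℝ => sin w.1) w := contDiff_sin.contDiffAt.comp w contDiffAt_fst
  have hc : ContDiffAt ℝ ∞ (fun w : ℝ × ℝ => cos w.1) w := contDiff_cos.contDiffAt.comp w contDiffAt_fst
  have hk' : ContDiffAt ℝ ∞ (fun w : ℝ × ℝ => w.2) w := contDiffAt_snd
  have hd : ContDiffAt ℝ ∞ (fun w : ℝ × ℝ => √(1 - w.2 ^ 2 * sin w.1 ^ 2)) w :=
    (contDiffAt_const.sub ((hk'.pow 2).mul (hs.pow 2))).sqrt (one_sub_pos hk w.1).ne'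
  refine ((contDiffAt_const.mul (contDiffAt_ellE hk)).sub (contDiffAt_ellF hk)).add
    ((hc.mul hs).mul ((hd.mul (ContDiffAt.sub ?_ contDiffAt_const)).div
      (ContDiffAt.add (contDiffAt_const.sub ?_) ((hk'.pow 2).mul ((hs.pow 2).pow 2)))
      (denom_pos (sq_nonneg _) hk).ne'))
  · exact (contDiffAt_const.mul (hk'.pow 2)).mul (hs.pow 2)
  · exact (contDiffAt_const.mul (hk'.pow 2)).mul (hs.pow 2)

/-! ### Signs of `a₁` and monotonicity of `G` -/

theorem sq_lt_one_of_mem {k : ℝ} (hk : k ∈ Ico (0 : ℝ) 1) : k ^ 2 < 1 := by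
  nlinarith [hk.1, hk.2]

theorem half_lt_sq {k : ℝ} (hk : 1 / √2 < k) : 1 / 2 < k ^ 2 := by
  have h : (0 : ℝ) < 1 / √2 := by positivity
  have h2 : (1 / √2 : ℝ) ^ 2 = 1 / 2 := by rw [div_pow]; norm_num
  rw [← h2]; gcongr

theorem pos_of_half_lt {k : ℝ} (hk : 1 / √2 < k) : 0 < k :=
  lt_trans (by positivity) hk

theorem sq_le_half {k : ℝ} (h0 : 0 ≤ k) (hk : k ≤ 1 / √2) : k ^ 2 ≤ 1 / 2 := by
  have h2 : (1 / √2 : ℝ) ^ 2 = 1 / 2 := by rw [div_pow]; norm_num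
  rw [← h2]; gcongr

theorem a₁_pi_sub (u k : ℝ) : a₁ (π - u) k = a₁ u k := by
  simp only [a₁_eq, sin_pi_sub]

theorem a₁_pi_div_two (k : ℝ) : a₁ (π / 2) k = 8 * (1 - k ^ 2) * (1 - 2 * k ^ 2) := by
  rw [a₁_eq, sin_pi_div_two]; ring

theorem a₁_pi_div_four_pos {k : ℝ} : 0 < a₁ (π / 4) k := by
  rw [a₁, show 2 * (π / 4) = π / 2 by ring, cos_pi_div_two]
  nlinarith [sq_nonneg (4 * k ^ 2 - 5)]

theorem continuous_a₁ (k : ℝ) : Continuous fun u => a₁ u k := by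
  unfold a₁; fun_prop

/-- As a quadratic in x = cos 2u, the difference of two values is x - y times a factor linear in x +
y; the latter is positive since |x + y| ≤ 2 and 0 < k < 1. -/
theorem a₁_strictAntiOn {k : ℝ} (hk : k ∈ Ioo (0 : ℝ) 1) :
    StrictAntiOn (fun u => a₁ u k) (Icc 0 (π / 2)) := by
  intro u hu v hv huv
  have hc : cos (2 * v) < cos (2 * u) :=
    cos_lt_cos_of_nonneg_of_le_pi (by linarith [hu.1]) (by linarith [hv.2]) (by linarith)
  have hk2 := sq_lt_one_of_mem ⟨hk.1.le, hk.2⟩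
  have hk0 : 0 < k ^ 2 := pow_pos hk.1 2
  have h1 : 0 < 4 * k ^ 2 * (3 - 2 * k ^ 2) +
      2 * k ^ 2 * (2 * k ^ 2 - 1) * (cos (2 * u) + cos (2 * v)) := by
    have h2 : 0 < 2 * (3 - 2 * k ^ 2) + (2 * k ^ 2 - 1) * (cos (2 * u) + cos (2 * v)) := by
      have a1 := cos_le_one (2 * u)
      have a2 := neg_one_le_cos (2 * u)
      have a3 := cos_le_one (2 * v)
      have a4 := neg_one_le_cos (2 * v)
      rcases le_total (2 * k ^ 2) 1 with h | h <;> nlinarith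
    nlinarith
  simp only [a₁]
  nlinarith [mul_pos (sub_pos.2 hc) h1]

theorem G_zero (k : ℝ) : G 0 k = 0 := by simp [G]

theorem G_pi_div_two (k : ℝ) : G (π / 2) k = 2 * compE k - compK k := by simp [G, compE, compK]

/-- Because of this, the zero sets in k at u = π/2 and at u = π coincide, so the branch κ starts and
ends at k₀. -/
theorem G_pi {k : ℝ} (hk : k ^ 2 < 1) : G π k = 2 * G (π / 2) k := by
  rw [G_pi_div_two, G, ellE_pi, ellF_pi hk, sin_pi]; ring

theorem continuous_G {k : ℝ} (hk : k ^ 2 < 1) : Continuous fun u => G u k :=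
  continuous_iff_continuousAt.2 fun u => (hasDerivAt_G hk u).continuousAt

theorem continuousOn_G_modulus (u : ℝ) : ContinuousOn (fun k => G u k) (Ico 0 1) := fun k hk =>
  ((contDiffAt_G (w := (u, k)) (sq_lt_one_of_mem hk)).continuousAt.comp
    (f := fun k => (u, k)) (by fun_prop)).continuousWithinAt

theorem deriv_G_pos_iff {k u : ℝ} (hk : k ^ 2 < 1) (hu : u ∈ Ioo 0 π) :
    0 < deriv (fun u => G u k) u ↔ 0 < a₁ u k := by
  have h1 := pow_pos (sin_pos_of_pos_of_lt_pi hu.1 hu.2) 2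
  have h2 := delta_pos hk u
  have h3 := pow_pos (denom_pos (z := sin u ^ 2) (sq_nonneg k) hk) 2
  rw [(hasDerivAt_G hk u).deriv, div_pos_iff_of_pos_right (by linarith), mul_pos_iff_of_pos_right h2,
    mul_pos_iff_of_pos_left h1]

theorem deriv_G_neg_iff {k u : ℝ} (hk : k ^ 2 < 1) (hu : u ∈ Ioo 0 π) :
    deriv (fun u => G u k) u < 0 ↔ a₁ u k < 0 := by
  have h1 := pow_pos (sin_pos_of_pos_of_lt_pi hu.1 hu.2) 2
  have h2 := delta_pos hk u
  have h3 := pow_pos (denom_pos (z := sin u ^ 2) (sq_nonneg k) hk) 2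
  rw [(hasDerivAt_G hk u).deriv, div_lt_iff₀ (by linarith), zero_mul, mul_right_comm]
  exact ⟨fun h => not_le.1 fun h' => (mul_nonneg (mul_pos h1 h2).le h').not_gt h,
    fun h => mul_neg_of_pos_of_neg (mul_pos h1 h2) h⟩

theorem a₁_eq_zero_of_deriv {k u : ℝ} (hk : k ^ 2 < 1) (hu : u ∈ Ioo 0 π)
    (h : deriv (fun u => G u k) u = 0) : a₁ u k = 0 :=
  le_antisymm (not_lt.1 fun h' => ((deriv_G_pos_iff hk hu).2 h').ne' h)
    (not_lt.1 fun h' => ((deriv_G_neg_iff hk hu).2 h').ne h)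

theorem strictMonoOn_G_of_a₁_pos {k a b : ℝ} (hk : k ^ 2 < 1) (ha : 0 ≤ a) (hb : b ≤ π)
    (h : ∀ u ∈ Ioo a b, 0 < a₁ u k) : StrictMonoOn (fun u => G u k) (Icc a b) := by
  refine strictMonoOn_of_deriv_pos (convex_Icc a b) (continuous_G hk).continuousOn fun u hu => ?_
  rw [interior_Icc] at hu
  exact (deriv_G_pos_iff hk ⟨ha.trans_lt hu.1, hu.2.trans_le hb⟩).2 (h u hu)

theorem strictAntiOn_G_of_a₁_neg {k a b : ℝ} (hk : k ^ 2 < 1) (ha : 0 ≤ a) (hb : b ≤ π)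
    (h : ∀ u ∈ Ioo a b, a₁ u k < 0) : StrictAntiOn (fun u => G u k) (Icc a b) := by
  refine strictAntiOn_of_deriv_neg (convex_Icc a b) (continuous_G hk).continuousOn fun u hu => ?_
  rw [interior_Icc] at hu
  exact (deriv_G_neg_iff hk ⟨ha.trans_lt hu.1, hu.2.trans_le hb⟩).2 (h u hu)

/-- For `k² ≤ 1/2` the function `G(·, k)` is positive on `(0, π]`. -/
theorem G_pos_of_sq_le_half {k u : ℝ} (hk : k ∈ Ioo (0 : ℝ) 1) (hk2 : k ^ 2 ≤ 1 / 2)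
    (hu : u ∈ Ioc 0 π) : 0 < G u k := by
  have hk1 : k ^ 2 < 1 := by linarith
  have hpi := pi_pos
  have hpos : ∀ u ∈ Ioo 0 (π / 2), 0 < a₁ u k := fun u hu => by
    have h1 := a₁_strictAntiOn hk ⟨hu.1.le, hu.2.le⟩ ⟨by linarith, le_rfl⟩ hu.2
    simp only [a₁_pi_div_two] at h1
    exact lt_of_le_of_lt (mul_nonneg (by linarith) (by linarith)) h1
  have hA := strictMonoOn_G_of_a₁_pos hk1 le_rfl (by linarith) hpos
  have hB := strictMonoOn_G_of_a₁_pos (a := π / 2) (b := π) hk1 (by linarith) le_rfl fun u hu => by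
    rw [← a₁_pi_sub]; exact hpos _ ⟨by linarith [hu.2], by linarith [hu.1]⟩
  have hA' : ∀ u ∈ Ioc 0 (π / 2), 0 < G u k := fun u hu => by
    simpa [G_zero] using hA ⟨le_rfl, by linarith⟩ ⟨hu.1.le, hu.2⟩ hu.1
  rcases le_total u (π / 2) with h | h
  · exact hA' u ⟨hu.1, h⟩
  · exact (hA' (π / 2) ⟨by linarith, le_rfl⟩).trans_le
      (hB.monotoneOn ⟨le_rfl, by linarith⟩ ⟨h, hu.2⟩ h)

theorem exists_a₁_eq_zero {k : ℝ} (hk : k ∈ Ioo (1 / √2) 1) :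
    ∃ v ∈ Ioo (π / 4) (π / 2), a₁ v k = 0 := by
  have h1 := half_lt_sq hk.1
  have h2 := sq_lt_one_of_mem ⟨(pos_of_half_lt hk.1).le, hk.2⟩
  have h3 : a₁ (π / 2) k < 0 := by
    rw [a₁_pi_div_two]; exact mul_neg_of_pos_of_neg (by linarith) (by linarith)
  exact intermediate_value_Ioo' (by linarith [pi_pos]) (continuous_a₁ k).continuousOn
    ⟨h3, a₁_pi_div_four_pos⟩

theorem mem_of_a₁_eq_zero {k v : ℝ} (hk : k ∈ Ioo (0 : ℝ) 1) (hv : v ∈ Ioo 0 (π / 2))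
    (ha : a₁ v k = 0) : π / 4 < v := by
  by_contra! h
  have := (a₁_strictAntiOn hk).antitoneOn ⟨hv.1.le, hv.2.le⟩
    ⟨by linarith [pi_pos], by linarith [pi_pos]⟩ h
  beta_reduce at this
  linarith [a₁_pi_div_four_pos (k := k)]

/-! ### The three monotone pieces of G(·, k) cut out by a zero v of `a₁` -/

section shape

variable {k v : ℝ} (hk : k ∈ Ioo (0 : ℝ) 1) (hv : v ∈ Ioo 0 (π / 2)) (ha : a₁ v k = 0)
include hk hv ha

theorem a₁_pos_left {u : ℝ} (hu : u ∈ Ico 0 v) : 0 < a₁ u k :=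
  ha ▸ a₁_strictAntiOn hk ⟨hu.1, by linarith [hu.2, hv.2]⟩ ⟨hv.1.le, hv.2.le⟩ hu.2

theorem a₁_neg_middle {u : ℝ} (hu : u ∈ Ioo v (π - v)) : a₁ u k < 0 := by
  have h : ∀ u ∈ Ioc v (π / 2), a₁ u k < 0 := fun u hu =>
    ha ▸ a₁_strictAntiOn hk ⟨hv.1.le, hv.2.le⟩ ⟨by linarith [hu.1, hv.1], hu.2⟩ hu.1
  rcases le_total u (π / 2) with h' | h'
  · exact h u ⟨hu.1, h'⟩
  · rw [← a₁_pi_sub]; exact h _ ⟨by linarith [hu.2], by linarith⟩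

theorem a₁_pos_right {u : ℝ} (hu : u ∈ Ioc (π - v) π) : 0 < a₁ u k := by
  rw [← a₁_pi_sub]
  exact a₁_pos_left hk hv ha ⟨by linarith [hu.2], by linarith [hu.1]⟩

theorem strictMonoOn_G_left : StrictMonoOn (fun u => G u k) (Icc 0 v) :=
  strictMonoOn_G_of_a₁_pos (sq_lt_one_of_mem ⟨hk.1.le, hk.2⟩) le_rfl (by linarith [hv.2, pi_pos])
    fun _ hu => a₁_pos_left hk hv ha ⟨hu.1.le, hu.2⟩

theorem strictAntiOn_G_middle : StrictAntiOn (fun u => G u k) (Icc v (π - v)) :=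
  strictAntiOn_G_of_a₁_neg (sq_lt_one_of_mem ⟨hk.1.le, hk.2⟩) hv.1.le (by linarith [hv.1])
    fun _ hu => a₁_neg_middle hk hv ha hu

theorem strictMonoOn_G_right : StrictMonoOn (fun u => G u k) (Icc (π - v) π) :=
  strictMonoOn_G_of_a₁_pos (sq_lt_one_of_mem ⟨hk.1.le, hk.2⟩) (by linarith [hv.2, pi_pos]) le_rfl
    fun _ hu => a₁_pos_right hk hv ha ⟨hu.1, hu.2.le⟩

theorem G_pos_left {u : ℝ} (hu : u ∈ Ioc 0 v) : 0 < G u k := by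
  simpa [G_zero] using strictMonoOn_G_left hk hv ha ⟨le_rfl, hv.1.le⟩ ⟨hu.1.le, hu.2⟩ hu.1

/-- On `[v, π]` the function `G(·, k)` attains its minimum at `π - v`. -/
theorem G_min_le {u : ℝ} (hu : u ∈ Icc v π) : G (π - v) k ≤ G u k := by
  rcases le_total u (π - v) with h | h
  · exact (strictAntiOn_G_middle hk hv ha).antitoneOn ⟨hu.1, h⟩ ⟨by linarith [hv.2], le_rfl⟩ h
  · exact (strictMonoOn_G_right hk hv ha).monotoneOn ⟨le_rfl, by linarith [hv.1]⟩ ⟨h, hu.2⟩ h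

end shape

/-! ### The numbers `k₀` and `k_*` -/

theorem compE_le (k : ℝ) : compE k ≤ π / 2 := by
  have : compE k ≤ ∫ _t in (0 : ℝ)..(π / 2), (1 : ℝ) :=
    intervalIntegral.integral_mono_on (by positivity)
      ((continuous_delta k).intervalIntegrable _ _) (by simp) fun t _ => sqrt_le_one.2 (by
        nlinarith [mul_nonneg (sq_nonneg k) (sq_nonneg (sin t))])
  simpa using this

/-- With q the complementary modulus, Δ² = q² + (1 - q²) cos² t ≤ (q + π/2 - t)², because cos t ≤
π/2 - t; then integrate the reciprocal. This makes K unbounded as k → 1. -/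
theorem log_le_compK {q : ℝ} (hq : 0 < q) (hq1 : q ≤ 1) :
    log (q + π / 2) - log q ≤ compK √(1 - q ^ 2) := by
  have hk : √(1 - q ^ 2) ^ 2 = 1 - q ^ 2 := sq_sqrt (by nlinarith)
  have hk1 : √(1 - q ^ 2) ^ 2 < 1 := by rw [hk]; nlinarith
  have hpos : ∀ t ∈ uIcc 0 (π / 2), 0 < q + π / 2 - t := fun t ht => by
    rw [uIcc_of_le (by positivity)] at ht; linarith [ht.2]
  have h1 : ∫ t in (0 : ℝ)..(π / 2), 1 / (q + π / 2 - t) = log (q + π / 2) - log q := by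
    have hd : ∀ t ∈ uIcc 0 (π / 2), HasDerivAt (fun t => -log (q + π / 2 - t))
        (1 / (q + π / 2 - t)) t := fun t ht => by
      refine (((hasDerivAt_id' t).const_sub (q + π / 2)).log (hpos t ht).ne').fun_neg.congr_deriv ?_
      ring
    rw [intervalIntegral.integral_eq_sub_of_hasDerivAt hd]
    · simp
      ring
    · exact ContinuousOn.intervalIntegrable (continuousOn_const.div (by fun_prop)
        fun t ht => (hpos t ht).ne')
  rw [← h1]
  refine intervalIntegral.integral_mono_on (by positivity) ?_
    ((continuous_inv_delta hk1).intervalIntegrable _ _) fun t ht => ?_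
  · exact ContinuousOn.intervalIntegrable (continuousOn_const.div (by fun_prop)
        fun t ht => (hpos t ht).ne')
  · have h2 : 0 ≤ cos t := cos_nonneg_of_mem_Icc ⟨by linarith [ht.1, pi_pos], ht.2⟩
    have h3 : cos t ≤ π / 2 - t := by
      rw [← sin_pi_div_two_sub]; exact sin_le (by linarith [ht.2])
    refine one_div_le_one_div_of_le (delta_pos hk1 t) (sqrt_le_iff.2 ⟨by linarith, ?_⟩)
    rw [hk, sin_sq]
    nlinarith [sq_nonneg (q * cos t)]

theorem exists_G_pi_div_two_neg : ∃ k ∈ Ioo (0 : ℝ) 1, G (π / 2) k < 0 := by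
  have hq : (0 : ℝ) < exp (-4) := exp_pos _
  have hq1 : exp (-4) < (1 : ℝ) := exp_lt_one_iff.2 (by norm_num)
  -- For complementary modulus e⁻⁴ the logarithmic bound gives K ≥ 4 > π ≥ 2E.
  refine ⟨√(1 - exp (-4) ^ 2), ⟨sqrt_pos.2 (by nlinarith), ?_⟩, ?_⟩
  · rw [sqrt_lt' one_pos]; nlinarith
  · have h1 := log_le_compK hq hq1.le
    have h2 : 0 ≤ log (exp (-4) + π / 2) := log_nonneg (by linarith [pi_gt_three])
    rw [log_exp] at h1
    rw [G_pi_div_two]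
    linarith [compE_le √(1 - exp (-4) ^ 2), pi_lt_four]

theorem inv_sqrt_two_mem : 1 / √2 ∈ Ioo (0 : ℝ) 1 := by
  refine ⟨by positivity, ?_⟩
  rw [div_lt_one (by positivity)]
  exact one_lt_sqrt_two

theorem G_pos_of_le_inv_sqrt_two {k u : ℝ} (hk : k ∈ Ioc 0 (1 / √2)) (hu : u ∈ Ioc 0 π) :
    0 < G u k :=
  G_pos_of_sq_le_half ⟨hk.1, hk.2.trans_lt inv_sqrt_two_mem.2⟩ (sq_le_half hk.1.le hk.2) hu

theorem exists_k₀ : ∃ k₀ ∈ Ioo (1 / √2) 1, G (π / 2) k₀ = 0 := by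
  obtain ⟨k₁, hk₁, h⟩ := exists_G_pi_div_two_neg
  have hpi := pi_pos
  have h2 := G_pos_of_le_inv_sqrt_two (k := 1 / √2) (u := π / 2) ⟨inv_sqrt_two_mem.1, le_rfl⟩
    ⟨by linarith, by linarith⟩
  have hlt : 1 / √2 < k₁ := by
    by_contra! h'
    linarith [G_pos_of_le_inv_sqrt_two (k := k₁) (u := π / 2) ⟨hk₁.1, h'⟩
      ⟨by linarith, by linarith⟩]
  obtain ⟨k, hk, hk'⟩ := intermediate_value_Ioo' hlt.le
    ((continuousOn_G_modulus (π / 2)).mono fun x hx =>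
      ⟨inv_sqrt_two_mem.1.le.trans hx.1, hx.2.trans_lt hk₁.2⟩) ⟨h, h2⟩
  exact ⟨k, ⟨hk.1, hk.2.trans hk₁.2⟩, hk'⟩

section branch

variable {k₀ : ℝ} (hk₀ : k₀ ∈ Ioo (1 / √2) 1) (h₀ : G (π / 2) k₀ = 0)
include hk₀ h₀

/-- At k₀ the function vanishes at both π/2 and π, and in between it first decreases strictly and
then increases strictly. -/
theorem G_neg_at_k₀ {u : ℝ} (hu : u ∈ Ioo (π / 2) π) : G u k₀ < 0 := by
  obtain ⟨v, hv, ha⟩ := exists_a₁_eq_zero hk₀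
  have hk : k₀ ∈ Ioo (0 : ℝ) 1 := ⟨pos_of_half_lt hk₀.1, hk₀.2⟩
  have hv' : v ∈ Ioo 0 (π / 2) := ⟨by linarith [hv.1, pi_pos], hv.2⟩
  rcases le_total u (π - v) with h | h
  · have := strictAntiOn_G_middle hk hv' ha ⟨hv.2.le, by linarith [hv.2]⟩
      ⟨by linarith [hv.2, hu.1], h⟩ hu.1
    simpa [h₀] using this
  · have := strictMonoOn_G_right hk hv' ha ⟨h, hu.2.le⟩ ⟨by linarith [hv'.1], le_rfl⟩ hu.2
    simpa [h₀, G_pi (sq_lt_one_of_mem ⟨hk.1.le, hk.2⟩)] using this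

theorem exists_modulus_zero {u : ℝ} (hu : u ∈ Icc (π / 2) π) :
    ∃ k ∈ Ioc (1 / √2) k₀, G u k = 0 ∧ (u ∈ Ioo (π / 2) π → k < k₀) := by
  have hpi := pi_pos
  by_cases hu' : u ∈ Ioo (π / 2) π
  · have h1 := G_neg_at_k₀ hk₀ h₀ hu'
    have h2 := G_pos_of_le_inv_sqrt_two (k := 1 / √2) (u := u) ⟨inv_sqrt_two_mem.1, le_rfl⟩
      ⟨by linarith [hu.1], hu.2⟩
    obtain ⟨k, hk, hk'⟩ := intermediate_value_Ioo' hk₀.1.le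
      ((continuousOn_G_modulus u).mono fun x hx =>
        ⟨inv_sqrt_two_mem.1.le.trans hx.1, hx.2.trans_lt hk₀.2⟩) ⟨h1, h2⟩
    exact ⟨k, ⟨hk.1, hk.2.le⟩, hk', fun _ => hk.2⟩
  · refine ⟨k₀, ⟨hk₀.1, le_rfl⟩, ?_, fun h => absurd h hu'⟩
    rcases hu.1.eq_or_lt with h | h
    · rw [← h, h₀]
    · obtain rfl : u = π := le_antisymm hu.2 (not_lt.1 fun h' => hu' ⟨h, h'⟩)
      rw [G_pi (sq_lt_one_of_mem ⟨(pos_of_half_lt hk₀.1).le, hk₀.2⟩), h₀, mul_zero]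

/-- Over `[π / 2, π]` the zero set of `G` is the graph `k = κ(u)` of a continuous function. -/
theorem exists_modulus_branch :
    ∃ κ : ℝ → ℝ, ContinuousOn κ (Icc (π / 2) π) ∧ κ (π / 2) = k₀ ∧ κ π = k₀ ∧
      (∀ u ∈ Icc (π / 2) π, κ u ∈ Ioc (1 / √2) k₀) ∧
      (∀ u ∈ Icc (π / 2) π, ∀ k ∈ Ico (0 : ℝ) 1, G u k = 0 ↔ k = κ u) ∧
      (∀ u ∈ Ioo (π / 2) π, κ u < k₀) := by
  choose! κ hκ hG hlt using fun u (hu : u ∈ Icc (π / 2) π) => exists_modulus_zero hk₀ h₀ hu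
  have hmem : ∀ u ∈ Icc (π / 2) π, κ u ∈ Ico (0 : ℝ) 1 := fun u hu =>
    ⟨(pos_of_half_lt (hκ u hu).1).le, (hκ u hu).2.trans_lt hk₀.2⟩
  have hiff : ∀ u ∈ Icc (π / 2) π, ∀ k ∈ Ico (0 : ℝ) 1, G u k = 0 ↔ k = κ u := by
    refine fun u hu k hk => ⟨fun h => ?_, fun h => h ▸ hG u hu⟩
    exact (strictAntiOn_G hu.1 hu.2).injOn hk (hmem u hu) (by simp [h, hG u hu])
  have hk₀' : k₀ ∈ Ico (0 : ℝ) 1 := ⟨(pos_of_half_lt hk₀.1).le, hk₀.2⟩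
  have hpi := pi_pos
  refine ⟨κ, fun u hu => ?_, ?_, ?_, hκ, hiff, fun u hu => hlt u ⟨hu.1.le, hu.2.le⟩ hu⟩
  · refine tendsto_order.2 ⟨fun a ha => ?_, fun a ha => ?_⟩
    -- Continuity of κ uses only monotonicity in k and continuity in u: the sign of G(u, ·) at a
    -- modulus on either side of κ(u) persists for nearby x and traps κ(x). The maximum with 0 keeps
    -- the modulus in [0, 1).
    · have hb : max a 0 < κ u := max_lt ha (pos_of_half_lt (hκ u hu).1)
      have hb1 : max a 0 ∈ Ico (0 : ℝ) 1 := ⟨le_max_right _ _, hb.trans (hmem u hu).2⟩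
      have h1 : 0 < G u (max a 0) := by
        simpa [hG u hu] using strictAntiOn_G hu.1 hu.2 hb1 (hmem u hu) hb
      have h2 := (continuous_G (sq_lt_one_of_mem hb1)).continuousAt.eventually (lt_mem_nhds h1)
      filter_upwards [self_mem_nhdsWithin, mem_nhdsWithin_of_mem_nhds h2] with x hx hx'
      refine (le_max_left a 0).trans_lt (not_le.1 fun h => ?_)
      have := (strictAntiOn_G hx.1 hx.2).antitoneOn (hmem x hx) hb1 h
      simp only [hG x hx] at this
      linarith
    · obtain ⟨b, hb, hb'⟩ := exists_between (lt_min ha (hmem u hu).2)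
      have hb1 : b ∈ Ico (0 : ℝ) 1 := ⟨(hmem u hu).1.trans hb.le, hb'.trans_le (min_le_right _ _)⟩
      have h1 : G u b < 0 := by
        simpa [hG u hu] using strictAntiOn_G hu.1 hu.2 (hmem u hu) hb1 hb
      have h2 := (continuous_G (sq_lt_one_of_mem hb1)).continuousAt.eventually (gt_mem_nhds h1)
      filter_upwards [self_mem_nhdsWithin, mem_nhdsWithin_of_mem_nhds h2] with x hx hx'
      refine lt_of_le_of_lt (not_lt.1 fun h => ?_) (hb'.trans_le (min_le_left _ _))
      have := strictAntiOn_G hx.1 hx.2 hb1 (hmem x hx) h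
      simp only [hG x hx] at this
      linarith
  · exact ((hiff _ ⟨le_rfl, by linarith⟩ _ hk₀').1 h₀).symm
  · refine ((hiff _ ⟨by linarith, le_rfl⟩ _ hk₀').1 ?_).symm
    rw [G_pi (sq_lt_one_of_mem hk₀'), h₀, mul_zero]

/-- k_* is the minimum of the continuous function κ over [π/2, π]. It is attained inside, since κ =
k₀ at the ends and κ < k₀ between them; monotonicity in k then turns κ ≥ k_* into G(·, k_*) ≥ 0. -/
theorem exists_kStar : ∃ kStar ∈ Ioo (1 / √2) k₀, (∃ u ∈ Ioo (π / 2) π, G u kStar = 0) ∧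
    ∀ u ∈ Icc (π / 2) π, 0 ≤ G u kStar := by
  obtain ⟨κ, hc, h1, h2, hκ, hiff, hlt⟩ := exists_modulus_branch hk₀ h₀
  have hpi := pi_pos
  obtain ⟨v, hv, hmin⟩ := isCompact_Icc.exists_isMinOn (nonempty_Icc.2 (by linarith)) hc
  have hmem : ∀ u ∈ Icc (π / 2) π, κ u ∈ Ico (0 : ℝ) 1 := fun u hu =>
    ⟨(pos_of_half_lt (hκ u hu).1).le, (hκ u hu).2.trans_lt hk₀.2⟩
  have h3 : κ v < k₀ := by
    have h4 : κ v ≤ κ (3 * π / 4) := isMinOn_iff.1 hmin _ ⟨by linarith, by linarith⟩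
    exact h4.trans_lt (hlt _ ⟨by linarith, by linarith⟩)
  have h5 : v ∈ Ioo (π / 2) π := by
    refine ⟨hv.1.lt_of_ne ?_, hv.2.lt_of_ne ?_⟩
    · rintro rfl; exact h3.ne h1
    · rintro rfl; exact h3.ne h2
  refine ⟨κ v, ⟨(hκ v hv).1, h3⟩, ⟨v, h5, (hiff v hv _ (hmem v hv)).2 rfl⟩, fun u hu => ?_⟩
  rw [← (hiff u hu _ (hmem u hu)).2 rfl]
  exact (strictAntiOn_G hu.1 hu.2).antitoneOn (hmem v hv) (hmem u hu) (isMinOn_iff.1 hmin u hu)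

end branch

/-! ### Algebra of `a₁` -/

theorem a₁_eq' (u k : ℝ) :
    a₁ u k = 8 * (1 - 2 * k ^ 2 * sin u ^ 2 + k ^ 2 * (2 * k ^ 2 - 1) * (sin u ^ 2) ^ 2) := by
  rw [a₁_eq]; ring

/-- In `a₁`/8 = 1 - 2k² sin² u + k²(2k² - 1) sin⁴ u the last term is nonnegative. The borderline 2k²
sin² u = 1 would force sin u = 0, where `a₁` = 8. -/
theorem one_lt_of_a₁_nonpos {k u : ℝ} (hk : 1 / √2 < k) (h : a₁ u k ≤ 0) :
    1 < 2 * k ^ 2 * sin u ^ 2 := by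
  have hk2 := half_lt_sq hk
  by_contra! h'
  rw [a₁_eq'] at h
  have h1 : 0 ≤ k ^ 2 * (2 * k ^ 2 - 1) * (sin u ^ 2) ^ 2 := by
    have : 0 ≤ 2 * k ^ 2 - 1 := by linarith
    positivity
  have h2 : k ^ 2 * (2 * k ^ 2 - 1) * (sin u ^ 2) ^ 2 = 0 := by linarith
  have h3 : sin u ^ 2 = 0 := by
    have h4 : k ^ 2 * (2 * k ^ 2 - 1) ≠ 0 := (mul_pos (by linarith) (by linarith)).ne'
    simpa [h4] using h2
  rw [h3] at h
  norm_num at h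

/-! ### The half-period -/

/-- This is sn(K - p) = cn p / dn p in terms of amplitudes. The left side has zero derivative and
equals K at π/2. At u = 0 the argument of arcsin is 1, so differentiability holds only inside and
the mean value theorem is used. -/
theorem ellF_add_ellF_arcsin {k : ℝ} (hk : k ^ 2 < 1) {u : ℝ} (hu : u ∈ Icc 0 (π / 2)) :
    ellF u k + ellF (arcsin (cos u / √(1 - k ^ 2 * sin u ^ 2))) k = compK k := by
  have hpi := pi_pos
  have hc : Continuous fun u => cos u / √(1 - k ^ 2 * sin u ^ 2) :=
    continuous_cos.div (continuous_delta k) fun u => (delta_pos hk u).ne'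
  have hd : ∀ x ∈ Ioo 0 (π / 2), HasDerivAt
      (fun u => ellF u k + ellF (arcsin (cos u / √(1 - k ^ 2 * sin u ^ 2))) k) 0 x := by
    intro x hx
    have hs : 0 < sin x := sin_pos_of_pos_of_lt_pi hx.1 (by linarith [hx.2])
    have hcx : 0 < cos x := cos_pos_of_mem_Ioo ⟨by linarith [hx.1], hx.2⟩
    have hD0 := delta_pos hk x
    have hD := delta_sq hk x
    set D := √(1 - k ^ 2 * sin x ^ 2) with hDdef
    have hq : 0 < √(1 - k ^ 2) := sqrt_pos.2 (by linarith)
    have hq2 : √(1 - k ^ 2) ^ 2 = 1 - k ^ 2 := sq_sqrt (by linarith)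
    set q := √(1 - k ^ 2)
    have e1 : 1 - (cos x / D) ^ 2 = (q * sin x / D) ^ 2 := by
      field_simp; rw [hD, hq2, cos_sq']; ring
    have hpos : 0 < q * sin x / D := by positivity
    have hlt : cos x / D < 1 := by nlinarith [div_pos hcx hD0]
    have hgt : -1 < cos x / D := by linarith [div_pos hcx hD0]
    have h1 := (hasDerivAt_cos x).fun_div (hasDerivAt_delta hk x) hD0.ne'
    have h2 := (hasDerivAt_arcsin hgt.ne' hlt.ne).comp x h1
    have h3 := (hasDerivAt_ellF hk (arcsin (cos x / D))).comp x h2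
    refine ((hasDerivAt_ellF hk x).fun_add h3).congr_deriv ?_
    rw [e1, sqrt_sq hpos.le, sin_arcsin hgt.le hlt.le, ← hDdef]
    have e2 : √(1 - k ^ 2 * (cos x / D) ^ 2) = q / D := by
      rw [show 1 - k ^ 2 * (cos x / D) ^ 2 = (q / D) ^ 2 by
        field_simp; rw [hD, hq2, cos_sq']; ring]
      exact sqrt_sq (by positivity)
    rw [e2]
    field_simp
    have e3 : -(sin x * D ^ 2) + cos x ^ 2 * k ^ 2 * sin x = -(q ^ 2 * sin x) := by
      rw [hD, hq2, cos_sq']; ring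
    nlinarith [e3]
  have hcont : ContinuousOn
      (fun u => ellF u k + ellF (arcsin (cos u / √(1 - k ^ 2 * sin u ^ 2))) k) (Icc 0 (π / 2)) :=
    ((continuous_ellF hk).add ((continuous_ellF hk).comp
      (continuous_arcsin.comp hc))).continuousOn
  have hend : ellF (π / 2) k + ellF (arcsin (cos (π / 2) / √(1 - k ^ 2 * sin (π / 2) ^ 2))) k =
      compK k := by simp [compK]
  rcases hu.2.eq_or_lt with rfl | hlt
  · exact hend
  · obtain ⟨c, hc, h⟩ := exists_hasDerivAt_eq_slope _ (fun _ => 0) hlt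
      (hcont.mono (Icc_subset_Icc_left hu.1)) fun x hx => hd x ⟨hu.1.trans_lt hx.1, hx.2⟩
    rw [eq_comm, div_eq_zero_iff, or_iff_left (by linarith)] at h
    linarith

/-- With q = √(1 - k²), the amplitude of K/2 has sin² = 1/(1 + q): it is the fixed point of the
reflection p ↦ K - p. There `a₁` equals 16 q³/(1 + q), so this amplitude lies to the left of every
zero of `a₁` in (0, π/2). -/
theorem exists_half_period {k : ℝ} (hk : k ∈ Ioo (0 : ℝ) 1) :
    ∃ a ∈ Ioo 0 (π / 2), ellF a k = compK k / 2 ∧ 0 < a₁ a k := by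
  have hk2 := sq_lt_one_of_mem ⟨hk.1.le, hk.2⟩
  have hq : 0 < √(1 - k ^ 2) := sqrt_pos.2 (by linarith)
  have hq2 : √(1 - k ^ 2) ^ 2 = 1 - k ^ 2 := sq_sqrt (by linarith)
  set q := √(1 - k ^ 2)
  have hz : 0 < 1 / (1 + q) := by positivity
  have hz1 : 1 / (1 + q) < 1 := by rw [div_lt_one (by linarith)]; linarith
  have hw := sq_sqrt hz.le
  have hw0 := sqrt_pos.2 hz
  set w := √(1 / (1 + q))
  have hw1 : w < 1 := by nlinarith
  have hs : sin (arcsin w) = w := sin_arcsin (by linarith) hw1.le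
  have ha : arcsin w ∈ Ioo 0 (π / 2) := ⟨arcsin_pos.2 hw0, arcsin_lt_pi_div_two.2 hw1⟩
  have hc : 0 < cos (arcsin w) := cos_pos_of_mem_Ioo ⟨by linarith [ha.1, pi_pos], ha.2⟩
  have hk2' : k ^ 2 = 1 - q ^ 2 := by linarith
  refine ⟨arcsin w, ha, ?_, ?_⟩
  · have h1 := ellF_add_ellF_arcsin hk2 ⟨ha.1.le, ha.2.le⟩
    have h2 : cos (arcsin w) / √(1 - k ^ 2 * sin (arcsin w) ^ 2) = w := by
      have h3 : (cos (arcsin w) / √(1 - k ^ 2 * sin (arcsin w) ^ 2)) ^ 2 = w ^ 2 := by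
        rw [div_pow, delta_sq hk2, cos_sq', hs, hw, hk2']
        have : 1 - (1 - q ^ 2) * (1 / (1 + q)) = q := by field_simp; ring
        rw [this]
        field_simp
        ring
      exact (pow_left_inj₀ (div_pos hc (delta_pos hk2 _)).le hw0.le two_ne_zero).1 h3
    rw [h2] at h1
    linarith
  · rw [a₁_eq', hs, hw, hk2']
    have : 8 * (1 - 2 * (1 - q ^ 2) * (1 / (1 + q)) +
        (1 - q ^ 2) * (2 * (1 - q ^ 2) - 1) * (1 / (1 + q)) ^ 2) = 16 * q ^ 3 / (1 + q) := by
      field_simp; ring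
    rw [this]
    positivity

/-! ### The first root -/

section kStar

variable {k₀ kStar : ℝ} (hk₀ : k₀ ∈ Ioo (1 / √2) 1) (h₀ : G (π / 2) k₀ = 0)
  (hkS : kStar ∈ Ioo (1 / √2) k₀) (hroot : ∃ u ∈ Ioo (π / 2) π, G u kStar = 0)
  (hmin : ∀ u ∈ Icc (π / 2) π, 0 ≤ G u kStar)

include hk₀ hkS hmin in
-- On [π/2, π] compare with G(·, k_*) ≥ 0. This interval contains π - v, the minimum point over [v,
-- π]; on (0, v] the function grows from 0.
theorem G_pos_of_lt_kStar {k u : ℝ} (hk : k ∈ Ioo 0 kStar) (hu : u ∈ Ioc 0 π) : 0 < G u k := by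
  have hpi := pi_pos
  have hk1 : k < 1 := hk.2.trans (hkS.2.trans hk₀.2)
  have hge : ∀ u ∈ Icc (π / 2) π, 0 < G u k := fun u hu =>
    (hmin u hu).trans_lt (strictAntiOn_G hu.1 hu.2 ⟨hk.1.le, hk1⟩
      ⟨(pos_of_half_lt hkS.1).le, hkS.2.trans hk₀.2⟩ hk.2)
  rcases le_or_gt k (1 / √2) with hkk | hkk
  · exact G_pos_of_le_inv_sqrt_two ⟨hk.1, hkk⟩ hu
  obtain ⟨v, hv, ha⟩ := exists_a₁_eq_zero ⟨hkk, hk1⟩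
  have hv' : v ∈ Ioo 0 (π / 2) := ⟨by linarith [hv.1], hv.2⟩
  rcases le_total u v with h | h
  · exact G_pos_left ⟨hk.1, hk1⟩ hv' ha ⟨hu.1, h⟩
  · exact (hge (π - v) ⟨by linarith [hv.2], by linarith [hv'.1]⟩).trans_le
      (G_min_le ⟨hk.1, hk1⟩ hv' ha ⟨h, hu.2⟩)

include hk₀ hkS hmin in
-- A zero of the nonnegative G(·, k_*) inside (π/2, π) is a local minimum, hence a critical point.
theorem a₁_eq_zero_at_kStar {u : ℝ} (hu : u ∈ Ioo (π / 2) π) (hG : G u kStar = 0) :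
    a₁ u kStar = 0 := by
  refine a₁_eq_zero_of_deriv
    (sq_lt_one_of_mem ⟨(pos_of_half_lt hkS.1).le, hkS.2.trans hk₀.2⟩)
    ⟨by linarith [hu.1, pi_pos], hu.2⟩ (IsLocalMin.deriv_eq_zero ?_)
  filter_upwards [Icc_mem_nhds hu.1 hu.2] with x hx
  rw [hG]; exact hmin x hx

include hk₀ hkS hroot hmin in
-- For a larger k in the set, 0 would be the minimum of G(·, k) over [v, π]; but at the root w of
-- G(·, k_*) the value has dropped below 0.
theorem isGreatest_kStar : IsGreatest {k : ℝ | k ∈ Ioo (1 / √2) k₀ ∧ ∃ u ∈ Ioo (π / 4) (π / 2),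
    a₁ u k = 0 ∧ h₁ (π - u) k = 0} kStar := by
  have hpi := pi_pos
  obtain ⟨w, hw, hGw⟩ := hroot
  have hS : kStar ∈ Ioo (0 : ℝ) 1 := ⟨pos_of_half_lt hkS.1, hkS.2.trans hk₀.2⟩
  refine ⟨⟨hkS, π - w, ⟨?_, by linarith [hw.1]⟩, ?_, ?_⟩, ?_⟩
  · refine mem_of_a₁_eq_zero hS ⟨by linarith [hw.2], by linarith [hw.1]⟩ ?_
    rw [a₁_pi_sub]; exact a₁_eq_zero_at_kStar hk₀ hkS hmin hw hGw
  · rw [a₁_pi_sub]; exact a₁_eq_zero_at_kStar hk₀ hkS hmin hw hGw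
  · rw [h₁_eq_zero_iff (sq_lt_one_of_mem ⟨hS.1.le, hS.2⟩), sub_sub_cancel, hGw]
  · rintro k ⟨hk, u, hu, ha, hh⟩
    have hk' : k ∈ Ioo (0 : ℝ) 1 := ⟨pos_of_half_lt hk.1, hk.2.trans hk₀.2⟩
    rw [h₁_eq_zero_iff (sq_lt_one_of_mem ⟨hk'.1.le, hk'.2⟩)] at hh
    have h1 : G (π - u) k ≤ G w k :=
      G_min_le hk' ⟨by linarith [hu.1], hu.2⟩ ha ⟨by linarith [hw.1, hu.2], hw.2.le⟩
    by_contra! hlt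
    have h2 := strictAntiOn_G hw.1.le hw.2.le ⟨hS.1.le, hS.2⟩ ⟨hk'.1.le, hk'.2⟩ hlt
    simp only [hGw] at h2
    linarith

/-- `u` is the first positive root of `G(·, k)`; it lies on the decreasing piece `(v, π - v]`. -/
structure IsFirstRoot (k v u : ℝ) : Prop where
  mem_v : v ∈ Ioo (π / 4) (π / 2)
  a₁_v : a₁ v k = 0
  mem : u ∈ Ioc v (π - v)
  root : G u k = 0
  pos : ∀ t ∈ Ioo 0 u, 0 < G t k

include hk₀ hkS hroot in
-- G is positive at v, while at π - v it is at most G(w, k) ≤ G(w, k_*) = 0, with strict inequality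
-- for k > k_*; so the decreasing piece crosses zero.
theorem exists_isFirstRoot {k : ℝ} (hk : k ∈ Ico kStar 1) :
    ∃ v u, IsFirstRoot k v u ∧ (kStar < k → u < π - v) := by
  have hpi := pi_pos
  obtain ⟨w, hw, hGw⟩ := hroot
  have hS : kStar ∈ Ioo (0 : ℝ) 1 := ⟨pos_of_half_lt hkS.1, hkS.2.trans hk₀.2⟩
  have hk' : k ∈ Ioo (0 : ℝ) 1 := ⟨hS.1.trans_le hk.1, hk.2⟩
  have hk2 := sq_lt_one_of_mem ⟨hk'.1.le, hk'.2⟩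
  obtain ⟨v, hv, ha⟩ := exists_a₁_eq_zero ⟨hkS.1.trans_le hk.1, hk.2⟩
  have hv' : v ∈ Ioo 0 (π / 2) := ⟨by linarith [hv.1], hv.2⟩
  have hA := strictAntiOn_G hw.1.le hw.2.le
  have h1 : G (π - v) k ≤ G w k := G_min_le hk' hv' ha ⟨by linarith [hw.1, hv.2], hw.2.le⟩
  have h2 : G w k ≤ 0 := by
    rw [← hGw]; exact hA.antitoneOn ⟨hS.1.le, hS.2⟩ ⟨hk'.1.le, hk'.2⟩ hk.1
  have h3 := G_pos_left hk' hv' ha ⟨hv'.1, le_rfl⟩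
  obtain ⟨u, hu, hGu⟩ := intermediate_value_Ioc' (by linarith [hv.2])
    (continuous_G hk2).continuousOn ⟨h1.trans h2, h3⟩ (a := v) (b := π - v)
  refine ⟨v, u, ⟨hv, ha, hu, hGu, fun t ht => ?_⟩, fun hlt => hu.2.lt_of_ne ?_⟩
  · rcases le_total t v with h | h
    · exact G_pos_left hk' hv' ha ⟨ht.1, h⟩
    · rw [← hGu]
      exact strictAntiOn_G_middle hk' hv' ha ⟨h, ht.2.le.trans hu.2⟩ ⟨hu.1.le, hu.2⟩ ht.2
  · rintro rfl
    have := hA ⟨hS.1.le, hS.2⟩ ⟨hk'.1.le, hk'.2⟩ hlt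
    simp only [hGw] at this
    linarith

end kStar

theorem mem_unit_of_half_lt {k : ℝ} (hk : k ∈ Ioo (1 / √2) 1) : k ∈ Ioo (0 : ℝ) 1 :=
  ⟨pos_of_half_lt hk.1, hk.2⟩

theorem sq_lt_one_of_half_lt {k : ℝ} (hk : k ∈ Ioo (1 / √2) 1) : k ^ 2 < 1 :=
  sq_lt_one_of_mem ⟨(pos_of_half_lt hk.1).le, hk.2⟩

section firstRoot

variable {k v u : ℝ} (h : IsFirstRoot k v u) (hk : k ∈ Ioo (1 / √2) 1)
include h

theorem IsFirstRoot.mem_v' : v ∈ Ioo 0 (π / 2) := ⟨by linarith [h.mem_v.1, pi_pos], h.mem_v.2⟩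

theorem IsFirstRoot.mem_pi : u ∈ Ioo 0 π :=
  ⟨h.mem_v'.1.trans h.mem.1, h.mem.2.trans_lt (by linarith [h.mem_v'.1])⟩

include hk

theorem IsFirstRoot.eq_of_mem {t : ℝ} (ht : t ∈ Icc 0 (π - v)) (ht0 : 0 < t) (hG : G t k = 0) :
    t = u := by
  have hvt : v < t := by
    by_contra! h'
    exact (G_pos_left (mem_unit_of_half_lt hk) h.mem_v' h.a₁_v ⟨ht0, h'⟩).ne' hG
  exact (strictAntiOn_G_middle (mem_unit_of_half_lt hk) h.mem_v' h.a₁_v).injOn ⟨hvt.le, ht.2⟩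
    ⟨h.mem.1.le, h.mem.2⟩ (by simp [hG, h.root])

/-- The condition `a₁` < 0 is open, so it passes to nearby implicit solutions and identifies them
with the first root, with no continuity of v or u₁ in k assumed. -/
theorem IsFirstRoot.eq_of_a₁_neg {t : ℝ} (ht : t ∈ Ioo 0 π) (hG : G t k = 0) (ha : a₁ t k < 0) :
    t = u := by
  refine h.eq_of_mem hk ⟨ht.1.le, ?_⟩ ht.1 hG
  by_contra! h'
  exact (a₁_pos_right (mem_unit_of_half_lt hk) h.mem_v' h.a₁_v ⟨h', ht.2.le⟩).not_gt ha

theorem IsFirstRoot.a₁_neg (hu : u < π - v) : a₁ u k < 0 :=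
  a₁_neg_middle (mem_unit_of_half_lt hk) h.mem_v' h.a₁_v ⟨h.mem.1, hu⟩

theorem IsFirstRoot.a₁_nonpos : a₁ u k ≤ 0 := by
  rcases h.mem.2.eq_or_lt with h' | h'
  · rw [h', a₁_pi_sub, h.a₁_v]
  · exact (h.a₁_neg hk h').le

theorem IsFirstRoot.isLeast : IsLeast {u : ℝ | 0 < u ∧ h₁ u k = 0} u := by
  refine ⟨⟨h.mem_pi.1, (h₁_eq_zero_iff (sq_lt_one_of_half_lt hk) u).2 h.root⟩, fun t ht => ?_⟩
  by_contra! h'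
  exact (h.pos t ⟨ht.1, h'⟩).ne' ((h₁_eq_zero_iff (sq_lt_one_of_half_lt hk) t).1 ht.2)

theorem IsFirstRoot.isLeast_g₁ : IsLeast {p : ℝ | 0 < p ∧ g₁ p k = 0} (ellF u k) := by
  have hk2 := sq_lt_one_of_half_lt hk
  have hmono := strictMono_ellF hk2
  refine ⟨⟨?_, ?_⟩, fun p hp => ?_⟩
  · simpa using hmono h.mem_pi.1
  · rw [g₁_eq hk2, jacAm_ellF hk2]; exact (h.isLeast hk).1.2
  · rw [mem_ofPred_eq, g₁_eq hk2] at hp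
    have h1 : 0 < jacAm p k := by
      rw [← hmono.lt_iff_lt]; simpa [ellF_jacAm hk2] using hp.1
    have h2 := hmono.monotone ((h.isLeast hk).2 ⟨h1, hp.2⟩)
    simpa [ellF_jacAm hk2] using h2

/-- The amplitude a of K/2 satisfies a < v, hence a < u < π - a, and F(π - a) = 2K - K/2. -/
theorem IsFirstRoot.half_lt : compK k / 2 < ellF u k ∧ ellF u k < 3 / 2 * compK k := by
  obtain ⟨a, ha, hF, hpos⟩ := exists_half_period (mem_unit_of_half_lt hk)
  have hk2 := sq_lt_one_of_half_lt hk
  have hav : a < v := by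
    by_contra! h'
    have := (a₁_strictAntiOn (mem_unit_of_half_lt hk)).antitoneOn ⟨h.mem_v'.1.le, h.mem_v'.2.le⟩
      ⟨ha.1.le, ha.2.le⟩ h'
    simp only [h.a₁_v] at this
    linarith
  have h1 := strictMono_ellF hk2 (hav.trans h.mem.1)
  have h2 := strictMono_ellF hk2 (h.mem.2.trans_lt (sub_lt_sub_left hav π))
  simp only [ellF_pi_sub hk2] at h1 h2
  constructor <;> linarith

theorem IsFirstRoot.lt_of_G_pi_div_two_neg (hneg : G (π / 2) k < 0) : ellF u k < compK k := by
  refine strictMono_ellF (sq_lt_one_of_half_lt hk) (not_le.1 fun h' => ?_)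
  rcases h'.eq_or_lt with h'' | h''
  · rw [h'', h.root] at hneg; exact hneg.ne rfl
  · exact (h.pos _ ⟨by positivity, h''⟩).not_gt hneg

theorem IsFirstRoot.lt_of_G_pi_div_two_pos (hpos : 0 < G (π / 2) k) : compK k < ellF u k := by
  refine strictMono_ellF (sq_lt_one_of_half_lt hk) (not_le.1 fun h' => ?_)
  have := (strictAntiOn_G_middle (mem_unit_of_half_lt hk) h.mem_v' h.a₁_v).antitoneOn
    ⟨h.mem.1.le, h.mem.2⟩ ⟨h.mem_v'.2.le, by linarith [h.mem_v'.2]⟩ h'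
  simp only [h.root] at this
  linarith

theorem IsFirstRoot.eq_pi_div_two (h0 : G (π / 2) k = 0) : u = π / 2 :=
  (h.eq_of_mem hk ⟨by positivity, by linarith [h.mem_v'.2]⟩ (by positivity) h0).symm

theorem IsFirstRoot.sn_mem : 2 * k ^ 2 * sin u ^ 2 - 1 ∈ Ioc (0 : ℝ) 1 := by
  refine ⟨by linarith [one_lt_of_a₁_nonpos hk.1 (h.a₁_nonpos hk)], ?_⟩
  nlinarith [sq_lt_one_of_half_lt hk, sin_sq_le_one u, sq_nonneg (sin u), sq_nonneg k]

end firstRoot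

/-! ### Smoothness -/

/-- The implicit function theorem for a scalar unknown. -/
theorem exists_contDiffAt_implicit {E : Type*} [NormedAddCommGroup E] [NormedSpace ℝ E]
    [CompleteSpace E] {f : E × ℝ → ℝ} {x : E} {u d : ℝ} (hf : ContDiffAt ℝ ∞ f (x, u))
    (hd : HasDerivAt (fun t => f (x, t)) d u) (hd0 : d ≠ 0) :
    ∃ ψ : E → ℝ, ContDiffAt ℝ ∞ ψ x ∧ ψ x = u ∧ ∀ᶠ y in 𝓝 x, f (y, ψ y) = f (x, u) := by
  have h1 : HasFDerivAt f (fderiv ℝ f (x, u)) (x, u) :=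
    (hf.differentiableAt (by simp)).hasFDerivAt
  have h2 : fderiv ℝ f (x, u) (0, 1) = d :=
    (h1.comp_hasDerivAt (f := fun t => (x, t)) u
      ((hasDerivAt_const u x).prodMk (hasDerivAt_id u))).unique hd
  have hinv : (fderiv ℝ f (x, u) ∘L ContinuousLinearMap.inr ℝ E ℝ).IsInvertible := by
    refine ⟨ContinuousLinearEquiv.unitsEquivAut ℝ (Units.mk0 d hd0), ?_⟩
    ext
    simp [h2]
  exact ⟨hf.implicitFunction (by simp) hinv, hf.contDiffAt_implicitFunction (by simp) hinv,
    hf.implicitFunction_apply_self (by simp) hinv,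
    hf.eventually_apply_implicitFunction (by simp) hinv⟩

/-- Apply the implicit function theorem to F(u, k) - p, whose u-derivative 1/Δ never vanishes;
injectivity of F(·, k) identifies the local solution with the amplitude. -/
theorem contDiffAt_jacAm {w : ℝ × ℝ} (hk : w.2 ^ 2 < 1) :
    ContDiffAt ℝ ∞ (fun w : ℝ × ℝ => jacAm w.1 w.2) w := by
  have hf : ContDiffAt ℝ ∞ (fun z : (ℝ × ℝ) × ℝ => ellF z.2 z.1.2 - z.1.1) (w, jacAm w.1 w.2) := by
    refine ContDiffAt.sub ?_ (by fun_prop)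
    exact (contDiffAt_ellF (w := (jacAm w.1 w.2, w.2)) hk).comp (w, jacAm w.1 w.2)
      (f := fun z : (ℝ × ℝ) × ℝ => (z.2, z.1.2)) (by fun_prop)
  obtain ⟨ψ, hψ, -, hev⟩ := exists_contDiffAt_implicit hf
    ((hasDerivAt_ellF hk (jacAm w.1 w.2)).sub_const w.1) (one_div_pos.2 (delta_pos hk _)).ne'
  refine hψ.congr_of_eventuallyEq ?_
  filter_upwards [hev, eventually_sq_lt_one hk] with y hy hy2
  simp only [ellF_jacAm hk, sub_self, sub_eq_zero] at hy
  rw [← jacAm_ellF hy2 (ψ y), hy]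

theorem contDiffAt_h₁ {w : ℝ × ℝ} (hk : w.2 ^ 2 < 1) :
    ContDiffAt ℝ ∞ (fun w : ℝ × ℝ => h₁ w.1 w.2) w := by
  have h : ContDiffAt ℝ ∞ (fun w : ℝ × ℝ =>
      (1 - 2 * w.2 ^ 2 * sin w.1 ^ 2 + w.2 ^ 2 * (sin w.1 ^ 2) ^ 2) * G w.1 w.2) w :=
    ContDiffAt.mul (by fun_prop) (contDiffAt_G hk)
  refine h.congr_of_eventuallyEq ?_
  filter_upwards [eventually_sq_lt_one hk] with y hy
  exact h₁_eq hy y.1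

theorem contDiffAt_g₁ {w : ℝ × ℝ} (hk : w.2 ^ 2 < 1) :
    ContDiffAt ℝ ∞ (fun w : ℝ × ℝ => g₁ w.1 w.2) w := by
  have h : ContDiffAt ℝ ∞ (fun w : ℝ × ℝ => h₁ (jacAm w.1 w.2) w.2) w :=
    (contDiffAt_h₁ (w := (jacAm w.1 w.2, w.2)) hk).comp w
      (f := fun w : ℝ × ℝ => (jacAm w.1 w.2, w.2)) ((contDiffAt_jacAm hk).prodMk contDiffAt_snd)
  refine h.congr_of_eventuallyEq ?_
  filter_upwards [eventually_sq_lt_one hk] with y hy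
  exact g₁_eq hy y.1

theorem g₁_ellF {k : ℝ} (hk : k ^ 2 < 1) (u : ℝ) : g₁ (ellF u k) k = h₁ u k := by
  rw [g₁_eq hk, jacAm_ellF hk]

theorem differentiableAt_G_modulus {u k : ℝ} (hk : k ^ 2 < 1) :
    DifferentiableAt ℝ (fun l => G u l) k :=
  ((contDiffAt_G (w := (u, k)) hk).differentiableAt (by simp)).comp k
    (f := fun l => (u, l)) (by fun_prop)

theorem differentiableAt_ellF_modulus {u k : ℝ} (hk : k ^ 2 < 1) :
    DifferentiableAt ℝ (fun l => ellF u l) k :=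
  ((contDiffAt_ellF (w := (u, k)) hk).differentiableAt (by simp)).comp k
    (f := fun l => (u, l)) (by fun_prop)

/-- The differential of `g₁` does not vanish at the zeros of `g₁`. -/
theorem fderiv_g₁_ne_zero {u k : ℝ} (hk : k ∈ Ioo (0 : ℝ) 1) (hu : u ∈ Ioo 0 π) (hG : G u k = 0) :
    fderiv ℝ (fun w : ℝ × ℝ => g₁ w.1 w.2) (ellF u k, k) ≠ 0 := by
  intro h0
  have hk2 := sq_lt_one_of_mem ⟨hk.1.le, hk.2⟩
  have hd : HasFDerivAt (fun w : ℝ × ℝ => g₁ w.1 w.2) 0 (ellF u k, k) :=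
    h0 ▸ ((contDiffAt_g₁ (w := (ellF u k, k)) hk2).differentiableAt (by simp)).hasFDerivAt
  have hf := denom_pos (z := sin u ^ 2) (sq_nonneg k) hk2
  have hs := hasDerivAt_sin_sq u
  -- Along t ↦ (F(t, k), k) the function `g₁` is f·G, where f > 0; at a zero of G only f·∂G/∂u
  -- survives.
  have hGu : deriv (fun t => G t k) u = 0 := by
    have h1 := hd.comp_hasDerivAt (f := fun t => (ellF t k, k)) u
      ((hasDerivAt_ellF hk2 u).prodMk (hasDerivAt_const u k))
    have h2 : ((fun w : ℝ × ℝ => g₁ w.1 w.2) ∘ fun t => (ellF t k, k)) = fun t =>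
        (1 - 2 * k ^ 2 * sin t ^ 2 + k ^ 2 * (sin t ^ 2) ^ 2) * G t k := by
      ext t; simp [g₁_ellF hk2, h₁_eq hk2]
    rw [h2] at h1
    have h3 := (((hs.const_mul (2 * k ^ 2)).const_sub 1).fun_add
      ((hs.fun_pow 2).const_mul (k ^ 2))).fun_mul (hasDerivAt_G hk2 u)
    have h4 := h3.unique h1
    rw [← (hasDerivAt_G hk2 u).deriv] at h4
    simpa [hG, hf.ne'] using h4
  have ha := a₁_eq_zero_of_deriv hk2 hu hGu
  have hlt : 1 / √2 < k := by
    by_contra! h'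
    exact (G_pos_of_le_inv_sqrt_two ⟨hk.1, h'⟩ ⟨hu.1, hu.2.le⟩).ne' hG
  -- A critical zero cannot lie left of π/2, where G has been increasing from 0 up to it, nor at
  -- π/2, where `a₁` ≠ 0.
  have hu2 : π / 2 < u := by
    by_contra! h'
    rcases h'.eq_or_lt with rfl | h'
    · rw [a₁_pi_div_two] at ha
      have := half_lt_sq hlt
      exact (mul_neg_of_pos_of_neg (by linarith) (by linarith)).ne ha
    · exact (G_pos_left hk ⟨hu.1, h'⟩ ha ⟨hu.1, le_rfl⟩).ne' hG
  have hdG := (differentiableAt_G_modulus (u := u) hk2).hasDerivAt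
  have hneg := G_deriv_modulus_neg hu2 hu.2 hk hdG
  -- Moving along l ↦ (F(u, l), l) keeps the amplitude fixed and so isolates the modulus derivative
  -- of G, which is negative.
  have h1 := hd.comp_hasDerivAt (f := fun l => (ellF u l, l)) k
    ((differentiableAt_ellF_modulus hk2).hasDerivAt.prodMk (hasDerivAt_id k))
  have h2 : (fun l => (1 - 2 * l ^ 2 * sin u ^ 2 + l ^ 2 * (sin u ^ 2) ^ 2) * G u l) =ᶠ[𝓝 k]
      ((fun w : ℝ × ℝ => g₁ w.1 w.2) ∘ fun l => (ellF u l, l)) := by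
    filter_upwards [Ioo_mem_nhds hk.1 hk.2] with l hl
    have := sq_lt_one_of_mem ⟨hl.1.le, hl.2⟩
    simp [g₁_ellF this, h₁_eq this]
  have h3 : DifferentiableAt ℝ
      (fun l => 1 - 2 * l ^ 2 * sin u ^ 2 + l ^ 2 * (sin u ^ 2) ^ 2) k := by fun_prop
  have h4 := (h3.hasDerivAt.fun_mul hdG).unique (h1.congr_of_eventuallyEq h2)
  simp only [hG, mul_zero, zero_add, zero_apply, mul_eq_zero, hf.ne', false_or] at h4
  exact hneg.ne h4

theorem mem_γg₁_iff {w : ℝ × ℝ} :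
    w ∈ γg₁ ↔ w.2 ∈ Ioo (0 : ℝ) 1 ∧ ∃ u ∈ Ioo 0 π, w.1 = ellF u w.2 ∧ G u w.2 = 0 := by
  refine and_congr_right fun hk => ?_
  have hk2 := sq_lt_one_of_mem ⟨hk.1.le, hk.2⟩
  have hmono := strictMono_ellF hk2
  constructor
  · rintro ⟨hp, hg⟩
    refine ⟨jacAm w.1 w.2, ⟨?_, ?_⟩, (ellF_jacAm hk2 _).symm, ?_⟩
    · rw [← hmono.lt_iff_lt]; simpa [ellF_jacAm hk2] using hp.1
    · rw [← hmono.lt_iff_lt]; simpa [ellF_jacAm hk2, ellF_pi hk2] using hp.2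
    · rwa [g₁_eq hk2, h₁_eq_zero_iff hk2] at hg
  · rintro ⟨u, hu, hp, hG⟩
    refine ⟨⟨?_, ?_⟩, ?_⟩
    · rw [hp]; simpa using hmono hu.1
    · rw [hp, ← ellF_pi hk2]; exact hmono hu.2
    · rwa [hp, g₁_ellF hk2, h₁_eq_zero_iff hk2]

theorem isSmoothPlaneCurve_γg₁ : IsSmoothPlaneCurve γg₁ := by
  intro z hz
  set f : ℝ × ℝ → ℝ := fun w => g₁ w.1 w.2
  set D : Set (ℝ × ℝ) := {w | w.2 ∈ Ioo (0 : ℝ) 1} with hD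
  have hDo : IsOpen D := isOpen_Ioo.preimage continuous_snd
  have hsq : ∀ w ∈ D, w.2 ^ 2 < 1 := fun w hw => sq_lt_one_of_mem ⟨hw.1.le, hw.2⟩
  have hf : ContDiffOn ℝ ∞ f D := fun w hw => (contDiffAt_g₁ (hsq w hw)).contDiffWithinAt
  have hK : ContinuousOn (fun w : ℝ × ℝ => 2 * compK w.2) D := fun w hw =>
    ((continuousAt_const.mul ((contDiffAt_ellF (w := (π / 2, w.2)) (hsq w hw)).continuousAt.comp
      (f := fun w : ℝ × ℝ => (π / 2, w.2)) (by fun_prop)))).continuousWithinAt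
  have hDp : IsOpen (D ∩ {w | w.1 ∈ Ioo 0 (2 * compK w.2)}) := by
    have h1 := (continuousOn_fst.prodMk hK).isOpen_inter_preimage hDo
      (isOpen_lt (continuous_fst) continuous_snd)
    have h2 := h1.inter ((isOpen_Ioi (a := (0 : ℝ))).preimage
      (continuous_fst : Continuous (Prod.fst : ℝ × ℝ → ℝ)))
    convert h2 using 1
    ext w
    simp only [mem_inter_iff, mem_ofPred_eq, mem_Ioo, mem_preimage, mem_Ioi]
    tauto
  have hU := ((hf.continuousOn_fderiv_of_isOpen hDo (by simp)).mono
    inter_subset_left).isOpen_inter_preimage hDp (isOpen_compl_singleton (x := 0))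
  obtain ⟨hk, u, hu, hp, hG⟩ := mem_γg₁_iff.1 hz
  refine ⟨_, hU, ⟨⟨hz.1, hz.2.1⟩, ?_⟩, f, hf.mono fun w hw => hw.1.1, fun w hw => hw.2, ?_⟩
  · have := fderiv_g₁_ne_zero hk hu hG
    rwa [← hp] at this
  · ext w
    exact ⟨fun hw => ⟨hw.2, hw.1.2.2⟩, fun hw => ⟨⟨hw.1.1.1, hw.1.1.2, hw.2⟩, hw.1⟩⟩

/-! ### Smoothness of the first root in k; connectedness of the zero set -/

section firstRoot

variable {kStar : ℝ} (hkS : kStar ∈ Ioo (1 / √2) 1) {v u₁ : ℝ → ℝ}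
  (hroot : ∀ k ∈ Ico kStar 1, IsFirstRoot k (v k) (u₁ k) ∧ (kStar < k → u₁ k < π - v k))
include hkS hroot

/-- For k > k_* the root lies strictly inside the decreasing piece, so ∂G/∂u < 0 and the implicit
function theorem applies. At k_* itself the root is the critical point π - v. -/
theorem contDiffAt_firstRoot {k : ℝ} (hk : k ∈ Ioo kStar 1) : ContDiffAt ℝ ∞ u₁ k := by
  have hk' : ∀ k ∈ Ico kStar 1, k ∈ Ioo (1 / √2) 1 := fun k hk => ⟨hkS.1.trans_le hk.1, hk.2⟩
  obtain ⟨h, hlt⟩ := hroot k ⟨hk.1.le, hk.2⟩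
  have hkk := hk' k ⟨hk.1.le, hk.2⟩
  have hk2 := sq_lt_one_of_half_lt hkk
  have ha := h.a₁_neg hkk (hlt hk.1)
  have hf : ContDiffAt ℝ ∞ (fun z : ℝ × ℝ => G z.2 z.1) (k, u₁ k) :=
    (contDiffAt_G (w := (u₁ k, k)) hk2).comp (k, u₁ k)
      (f := fun z : ℝ × ℝ => (z.2, z.1)) (by fun_prop)
  have hd := (deriv_G_neg_iff hk2 h.mem_pi).2 ha
  obtain ⟨ψ, hψ, hψ0, hev⟩ := exists_contDiffAt_implicit hf
    (hasDerivAt_G hk2 (u₁ k)).differentiableAt.hasDerivAt hd.ne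
  have hca : ContinuousAt (fun l => a₁ (ψ l) l) k := by
    have := hψ.continuousAt
    unfold a₁
    fun_prop
  refine hψ.congr_of_eventuallyEq ?_
  filter_upwards [hev, Ioo_mem_nhds hk.1 hk.2,
    hψ.continuousAt.eventually (Ioo_mem_nhds (hψ0 ▸ h.mem_pi.1) (hψ0 ▸ h.mem_pi.2)),
    hca.eventually (gt_mem_nhds (by simpa only [hψ0] using ha))] with l h1 h2 h3 h4
  exact ((hroot l ⟨h2.1.le, h2.2⟩).1.eq_of_a₁_neg (hk' l ⟨h2.1.le, h2.2⟩) h3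
    (h1.trans h.root) h4).symm

theorem contDiffAt_ellF_firstRoot {k : ℝ} (hk : k ∈ Ioo kStar 1) :
    ContDiffAt ℝ ∞ (fun k => ellF (u₁ k) k) k :=
  (contDiffAt_ellF (w := (u₁ k, k))
    (sq_lt_one_of_half_lt ⟨hkS.1.trans hk.1, hk.2⟩)).comp k
    (f := fun k => (u₁ k, k)) ((contDiffAt_firstRoot hkS hroot hk).prodMk contDiffAt_id)

theorem isConnected_γg₁ {k₀ : ℝ} (hk₀ : k₀ ∈ Ioo (1 / √2) 1) (h₀ : G (π / 2) k₀ = 0)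
    (hlt : kStar < k₀) (hmin : ∀ u ∈ Icc (π / 2) π, 0 ≤ G u kStar) : IsConnected γg₁ := by
  have hpi := pi_pos
  obtain ⟨κ, hκc, hκ1, -, hκm, hκ, -⟩ := exists_modulus_branch hk₀ h₀
  have hsub : Ico (π / 2) π ⊆ Icc (π / 2) π := Ico_subset_Icc_self
  have hunit : ∀ u ∈ Icc (π / 2) π, κ u ∈ Ioo (0 : ℝ) 1 := fun u hu =>
    ⟨pos_of_half_lt (hκm u hu).1, (hκm u hu).2.trans_lt hk₀.2⟩
  have hfull : ∀ k ∈ Ico kStar 1, k ∈ Ioo (1 / √2) 1 := fun k hk => ⟨hkS.1.trans_le hk.1, hk.2⟩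
  have hkS' : kStar ∈ Ioo (1 / √2) k₀ := ⟨hkS.1, hlt⟩
  -- A carries the zeros with amplitude at least π/2, B those with amplitude at most π/2; the common
  -- point has amplitude π/2 and modulus k₀.
  set A := (fun u => (ellF u (κ u), κ u)) '' Ico (π / 2) π
  set B := (fun k => (ellF (u₁ k) k, k)) '' Ico k₀ 1
  have hA : IsConnected A := by
    refine (isConnected_Ico (by linarith)).image _ (ContinuousOn.prodMk ?_ (hκc.mono hsub))
    intro u hu
    exact ((contDiffAt_ellF (w := (u, κ u)) (sq_lt_one_of_mem
      ⟨(hunit u (hsub hu)).1.le, (hunit u (hsub hu)).2⟩)).continuousAt.comp_continuousWithinAt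
      (f := fun u => (u, κ u)) (continuousWithinAt_id.prodMk ((hκc.mono hsub) u hu)))
  have hB : IsConnected B := by
    refine (isConnected_Ico hk₀.2).image _ (ContinuousOn.prodMk ?_ continuousOn_id)
    exact fun k hk => (contDiffAt_ellF_firstRoot hkS hroot
      ⟨hlt.trans_le hk.1, hk.2⟩).continuousAt.continuousWithinAt
  have hk₀S : k₀ ∈ Ico kStar 1 := ⟨hlt.le, hk₀.2⟩
  have hAB : (A ∩ B).Nonempty := by
    refine ⟨(ellF (π / 2) k₀, k₀), ⟨π / 2, ⟨le_rfl, by linarith⟩, by simp [hκ1]⟩,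
      k₀, ⟨le_rfl, hk₀.2⟩, ?_⟩
    simp only [(hroot k₀ hk₀S).1.eq_pi_div_two hk₀ h₀]
  have hunion : γg₁ = A ∪ B := by
    ext ⟨p, k⟩
    rw [mem_γg₁_iff]
    constructor
    · rintro ⟨hk, u, hu, hp, hG⟩
      simp only at hk hp hG
      have hkS2 : kStar ≤ k := by
        by_contra! h'
        exact (G_pos_of_lt_kStar hk₀ hkS' hmin ⟨hk.1, h'⟩ ⟨hu.1, hu.2.le⟩).ne' hG
      rcases le_or_gt (π / 2) u with h | h
      · left
        have := (hκ u ⟨h, hu.2.le⟩ k ⟨hk.1.le, hk.2⟩).1 hG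
        exact ⟨u, ⟨h, hu.2⟩, by simp [← this, hp]⟩
      · right
        have hr := (hroot k ⟨hkS2, hk.2⟩).1
        have huu : u = u₁ k := hr.eq_of_mem (hfull k ⟨hkS2, hk.2⟩)
          ⟨hu.1.le, by linarith [hr.mem_v'.2]⟩ hu.1 hG
        refine ⟨k, ⟨?_, hk.2⟩, by simp [← huu, hp]⟩
        -- For k < k₀ one has G(π/2, k) > 0, which puts the first root to the right of π/2.
        by_contra! h'
        have h1 := strictAntiOn_G (u := π / 2) le_rfl (by linarith) ⟨hk.1.le, hk.2⟩
          ⟨(pos_of_half_lt hk₀.1).le, hk₀.2⟩ h'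
        simp only [h₀] at h1
        have h2 := strictMono_ellF (sq_lt_one_of_mem ⟨hk.1.le, hk.2⟩) h
        have h3 := hr.lt_of_G_pi_div_two_pos (hfull k ⟨hkS2, hk.2⟩) h1
        rw [← huu] at h3
        exact (h2.trans h3).ne rfl
    · rintro (⟨u, hu, he⟩ | ⟨l, hl, he⟩)
      · simp only [Prod.mk.injEq] at he
        obtain ⟨rfl, rfl⟩ := he
        exact ⟨hunit u (hsub hu), u, ⟨by linarith [hu.1], hu.2⟩, rfl,
          (hκ u (hsub hu) _ (Ioo_subset_Ico_self (hunit u (hsub hu)))).2 rfl⟩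
      · simp only [Prod.mk.injEq] at he
        obtain ⟨rfl, rfl⟩ := he
        have hlS : l ∈ Ico kStar 1 := ⟨hlt.le.trans hl.1, hl.2⟩
        exact ⟨mem_unit_of_half_lt (hfull l hlS), u₁ l, (hroot l hlS).1.mem_pi, rfl,
          (hroot l hlS).1.root⟩
  rw [hunion]
  exact hA.union hAB hB

end firstRoot

/-! ### Jacobi's functions -/

section jacobi

variable {k : ℝ} (hk : k ^ 2 < 1)

theorem jacCn_sq (p k : ℝ) : jacCn p k ^ 2 = 1 - jacSn p k ^ 2 := cos_sq' _

include hk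

theorem jacDn_sq (p : ℝ) : jacDn p k ^ 2 = 1 - k ^ 2 * jacSn p k ^ 2 := delta_sq hk _

theorem jacDn_pos (p : ℝ) : 0 < jacDn p k := delta_pos hk _

theorem hasDerivAt_jacAm (p : ℝ) : HasDerivAt (fun p => jacAm p k) (jacDn p k) p := by
  have hc : ContinuousAt (fun p => jacAm p k) p :=
    (contDiffAt_jacAm (w := (p, k)) hk).continuousAt.comp (f := fun p => (p, k)) (by fun_prop)
  have := HasDerivAt.of_local_left_inverse hc (hasDerivAt_ellF hk (jacAm p k))
    (one_div_pos.2 (delta_pos hk _)).ne' (Eventually.of_forall fun y => ellF_jacAm hk y)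
  simpa [jacDn, jacSn] using this

theorem hasDerivAt_jacSn (p : ℝ) :
    HasDerivAt (fun p => jacSn p k) (jacCn p k * jacDn p k) p :=
  (hasDerivAt_jacAm hk p).sin

theorem hasDerivAt_jacCn (p : ℝ) :
    HasDerivAt (fun p => jacCn p k) (-jacSn p k * jacDn p k) p :=
  (hasDerivAt_jacAm hk p).cos

theorem hasDerivAt_jacDn (p : ℝ) :
    HasDerivAt (fun p => jacDn p k) (-(k ^ 2 * jacSn p k * jacCn p k)) p := by
  refine ((hasDerivAt_delta hk (jacAm p k)).comp p (hasDerivAt_jacAm hk p)).congr_deriv ?_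
  exact div_mul_cancel₀ _ (jacDn_pos hk p).ne'

theorem hasDerivAt_jacEps (p : ℝ) :
    HasDerivAt (fun p => jacEps p k) (jacDn p k ^ 2) p := by
  refine ((hasDerivAt_ellE k (jacAm p k)).comp p (hasDerivAt_jacAm hk p)).congr_deriv ?_
  exact (sq (jacDn p k)).symm

theorem jacAm_zero : jacAm 0 k = 0 := by simpa using jacAm_ellF hk 0

theorem jacSn_zero : jacSn 0 k = 0 := by simp [jacSn, jacAm_zero hk]

theorem jacCn_zero : jacCn 0 k = 1 := by simp [jacCn, jacAm_zero hk]

theorem jacDn_zero : jacDn 0 k = 1 := by simp [jacDn, jacSn_zero hk]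

theorem jacEps_zero : jacEps 0 k = 0 := by simp [jacEps, jacAm_zero hk]

omit hk in
theorem eq_of_hasDerivAt_zero {f : ℝ → ℝ} (h : ∀ x, HasDerivAt f 0 x) (x y : ℝ) : f x = f y :=
  is_const_of_deriv_eq_zero (fun x => (h x).differentiableAt) (fun x => (h x).deriv) x y

omit hk in
theorem ellE_neg (u : ℝ) : ellE (-u) k = -ellE u k := by
  have := eq_of_hasDerivAt_zero (f := fun u => ellE (-u) k + ellE u k) (fun x => by
    refine (((hasDerivAt_ellE k (-x)).comp x (hasDerivAt_neg x)).add
      (hasDerivAt_ellE k x)).congr_deriv ?_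
    rw [sin_neg, neg_sq]; ring) u 0
  simp at this
  linarith

theorem ellF_neg (u : ℝ) : ellF (-u) k = -ellF u k := by
  have := eq_of_hasDerivAt_zero (f := fun u => ellF (-u) k + ellF u k) (fun x => by
    refine (((hasDerivAt_ellF hk (-x)).comp x (hasDerivAt_neg x)).add
      (hasDerivAt_ellF hk x)).congr_deriv ?_
    rw [sin_neg, neg_sq]; ring) u 0
  simp at this
  linarith

theorem jacAm_neg (p : ℝ) : jacAm (-p) k = -jacAm p k := by
  refine (strictMono_ellF hk).injective ?_
  simp only [ellF_jacAm hk, ellF_neg hk]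

theorem jacSn_neg (p : ℝ) : jacSn (-p) k = -jacSn p k := by simp [jacSn, jacAm_neg hk]

theorem jacCn_neg (p : ℝ) : jacCn (-p) k = jacCn p k := by simp [jacCn, jacAm_neg hk]

theorem jacDn_neg (p : ℝ) : jacDn (-p) k = jacDn p k := by simp [jacDn, jacSn_neg hk]

theorem jacEps_neg (p : ℝ) : jacEps (-p) k = -jacEps p k := by
  simp [jacEps, jacAm_neg hk, ellE_neg]

omit hk in
theorem jacSn_sq_le_one (p : ℝ) : jacSn p k ^ 2 ≤ 1 := sin_sq_le_one _

/-! ### Addition theorems for sn, cn, dn and the epsilon function -/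

theorem addition_denom_pos (u v : ℝ) : 0 < 1 - k ^ 2 * jacSn u k ^ 2 * jacSn v k ^ 2 := by
  have h1 := jacDn_sq hk u ▸ pow_pos (jacDn_pos hk u) 2
  nlinarith [mul_nonneg (mul_nonneg (sq_nonneg k) (sq_nonneg (jacSn u k)))
    (sub_nonneg.2 (jacSn_sq_le_one (k := k) v))]

/-- The left side is the product of the numerators of sn(v + u) and sn(v - u). -/
theorem addition_identity (u v : ℝ) :
    jacSn v k ^ 2 * jacCn u k ^ 2 * jacDn u k ^ 2 - jacSn u k ^ 2 * jacCn v k ^ 2 * jacDn v k ^ 2 =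
      (jacSn v k ^ 2 - jacSn u k ^ 2) * (1 - k ^ 2 * jacSn u k ^ 2 * jacSn v k ^ 2) := by
  rw [jacDn_sq hk, jacDn_sq hk, jacCn_sq, jacCn_sq]; ring

omit hk in
theorem hasDerivAt_comp_const_sub {f : ℝ → ℝ} {f' σ x : ℝ} (h : HasDerivAt f f' (σ - x)) :
    HasDerivAt (fun x => f (σ - x)) (-f') x := by
  simpa using h.comp_const_sub σ x

theorem hasDerivAt_addition_denom (σ x : ℝ) :
    HasDerivAt (fun x => 1 - k ^ 2 * jacSn x k ^ 2 * jacSn (σ - x) k ^ 2)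
      (-(2 * k ^ 2 * jacSn x k * jacSn (σ - x) k * (jacCn x k * jacDn x k * jacSn (σ - x) k -
        jacSn x k * jacCn (σ - x) k * jacDn (σ - x) k))) x := by
  have h1 := hasDerivAt_jacSn hk x
  have h2 := hasDerivAt_comp_const_sub (hasDerivAt_jacSn hk (σ - x))
  refine ((((h1.fun_pow 2).const_mul (k ^ 2)).fun_mul (h2.fun_pow 2)).const_sub 1).congr_deriv ?_
  simp only [Nat.cast_ofNat, Nat.add_one_sub_one, pow_one]
  ring

/-- Replace (u, v) by (x, u + v - x): the right side then has zero x-derivative, and comparing x = u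
with x = 0 gives the formula. The theorems for cn, dn and epsilon use the same device. -/
theorem jacSn_add (u v : ℝ) :
    jacSn (u + v) k = (jacSn u k * jacCn v k * jacDn v k + jacSn v k * jacCn u k * jacDn u k) /
      (1 - k ^ 2 * jacSn u k ^ 2 * jacSn v k ^ 2) := by
  have key := eq_of_hasDerivAt_zero (f := fun x =>
    (jacSn x k * jacCn (u + v - x) k * jacDn (u + v - x) k +
      jacSn (u + v - x) k * jacCn x k * jacDn x k) /
      (1 - k ^ 2 * jacSn x k ^ 2 * jacSn (u + v - x) k ^ 2)) (fun x => by
    have s := hasDerivAt_jacSn hk x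
    have c := hasDerivAt_jacCn hk x
    have d := hasDerivAt_jacDn hk x
    have S := hasDerivAt_comp_const_sub (hasDerivAt_jacSn hk (u + v - x))
    have C := hasDerivAt_comp_const_sub (hasDerivAt_jacCn hk (u + v - x))
    have E := hasDerivAt_comp_const_sub (hasDerivAt_jacDn hk (u + v - x))
    refine ((((s.fun_mul C).fun_mul E).fun_add ((S.fun_mul c).fun_mul d)).fun_div
      (hasDerivAt_addition_denom hk (u + v) x)
      (addition_denom_pos hk x (u + v - x)).ne').congr_deriv ?_
    rw [div_eq_zero_iff]
    left
    have h := addition_identity hk x (u + v - x)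
    clear s c d S C E
    have hd := jacDn_sq hk x
    have hD := jacDn_sq hk (u + v - x)
    have hc := jacCn_sq x k
    have hC := jacCn_sq (u + v - x) k
    generalize jacSn x k = s at *
    generalize jacCn x k = c at *
    generalize jacDn x k = d at *
    generalize jacSn (u + v - x) k = S at *
    generalize jacCn (u + v - x) k = C at *
    generalize jacDn (u + v - x) k = E at *
    linear_combination (1 - k ^ 2 * s ^ 2 * S ^ 2) * s * S * (hD - hd + k ^ 2 * hC - k ^ 2 * hc) +
      2 * k ^ 2 * s * S * h) u 0
  simpa [jacSn_zero hk, jacCn_zero hk, jacDn_zero hk] using key.symm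

theorem jacCn_add (u v : ℝ) :
    jacCn (u + v) k = (jacCn u k * jacCn v k - jacSn u k * jacSn v k * jacDn u k * jacDn v k) /
      (1 - k ^ 2 * jacSn u k ^ 2 * jacSn v k ^ 2) := by
  have key := eq_of_hasDerivAt_zero (f := fun x =>
    (jacCn x k * jacCn (u + v - x) k -
      jacSn x k * jacSn (u + v - x) k * jacDn x k * jacDn (u + v - x) k) /
      (1 - k ^ 2 * jacSn x k ^ 2 * jacSn (u + v - x) k ^ 2)) (fun x => by
    have s := hasDerivAt_jacSn hk x
    have c := hasDerivAt_jacCn hk x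
    have d := hasDerivAt_jacDn hk x
    have S := hasDerivAt_comp_const_sub (hasDerivAt_jacSn hk (u + v - x))
    have C := hasDerivAt_comp_const_sub (hasDerivAt_jacCn hk (u + v - x))
    have E := hasDerivAt_comp_const_sub (hasDerivAt_jacDn hk (u + v - x))
    refine (((c.fun_mul C).fun_sub (((s.fun_mul S).fun_mul d).fun_mul E)).fun_div
      (hasDerivAt_addition_denom hk (u + v) x)
      (addition_denom_pos hk x (u + v - x)).ne').congr_deriv ?_
    rw [div_eq_zero_iff]
    left
    clear s c d S C E
    have hd := jacDn_sq hk x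
    have hD := jacDn_sq hk (u + v - x)
    have hc := jacCn_sq x k
    have hC := jacCn_sq (u + v - x) k
    generalize jacSn x k = s at *
    generalize jacCn x k = c at *
    generalize jacDn x k = d at *
    generalize jacSn (u + v - x) k = S at *
    generalize jacCn (u + v - x) k = C at *
    generalize jacDn (u + v - x) k = E at *
    linear_combination (1 - k ^ 2 * s ^ 2 * S ^ 2) * (s * d * C * hD - c * S * E * hd) +
      2 * k ^ 2 * s * S * (S * d * C * (hc + s ^ 2 * hD) - s * c * E * (hC + S ^ 2 * hd))) u 0
  simpa [jacSn_zero hk, jacCn_zero hk, jacDn_zero hk] using key.symm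

theorem jacDn_add (u v : ℝ) :
    jacDn (u + v) k =
      (jacDn u k * jacDn v k - k ^ 2 * jacSn u k * jacSn v k * jacCn u k * jacCn v k) /
      (1 - k ^ 2 * jacSn u k ^ 2 * jacSn v k ^ 2) := by
  have key := eq_of_hasDerivAt_zero (f := fun x =>
    (jacDn x k * jacDn (u + v - x) k -
      k ^ 2 * jacSn x k * jacSn (u + v - x) k * jacCn x k * jacCn (u + v - x) k) /
      (1 - k ^ 2 * jacSn x k ^ 2 * jacSn (u + v - x) k ^ 2)) (fun x => by
    have s := hasDerivAt_jacSn hk x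
    have c := hasDerivAt_jacCn hk x
    have d := hasDerivAt_jacDn hk x
    have S := hasDerivAt_comp_const_sub (hasDerivAt_jacSn hk (u + v - x))
    have C := hasDerivAt_comp_const_sub (hasDerivAt_jacCn hk (u + v - x))
    have E := hasDerivAt_comp_const_sub (hasDerivAt_jacDn hk (u + v - x))
    refine (((d.fun_mul E).fun_sub ((((s.const_mul (k ^ 2)).fun_mul S).fun_mul c).fun_mul C)).fun_div
      (hasDerivAt_addition_denom hk (u + v) x)
      (addition_denom_pos hk x (u + v - x)).ne').congr_deriv ?_
    rw [div_eq_zero_iff]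
    left
    clear s c d S C E
    have hd := jacDn_sq hk x
    have hD := jacDn_sq hk (u + v - x)
    have hc := jacCn_sq x k
    have hC := jacCn_sq (u + v - x) k
    generalize jacSn x k = s at *
    generalize jacCn x k = c at *
    generalize jacDn x k = d at *
    generalize jacSn (u + v - x) k = S at *
    generalize jacCn (u + v - x) k = C at *
    generalize jacDn (u + v - x) k = E at *
    linear_combination (1 - k ^ 2 * s ^ 2 * S ^ 2) * k ^ 2 * (s * c * E * hC - S * d * C * hc) +
      2 * k ^ 2 * s * S * (S * c * E * (hd + k ^ 2 * s ^ 2 * hC) -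
        s * d * C * (hD + k ^ 2 * S ^ 2 * hc))) u 0
  simpa [jacSn_zero hk, jacCn_zero hk, jacDn_zero hk] using key.symm

theorem jacEps_add (u v : ℝ) :
    jacEps (u + v) k =
      jacEps u k + jacEps v k - k ^ 2 * jacSn u k * jacSn v k * jacSn (u + v) k := by
  have key := eq_of_hasDerivAt_zero (f := fun x =>
    jacEps x k + jacEps (u + v - x) k -
      k ^ 2 * jacSn x k * jacSn (u + v - x) k * jacSn (u + v) k) (fun x => by
    have s := hasDerivAt_jacSn hk x
    have S := hasDerivAt_comp_const_sub (hasDerivAt_jacSn hk (u + v - x))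
    have e := hasDerivAt_jacEps hk x
    have E := hasDerivAt_comp_const_sub (hasDerivAt_jacEps hk (u + v - x))
    refine ((e.fun_add E).fun_sub
      (((s.const_mul (k ^ 2)).fun_mul S).mul_const (jacSn (u + v) k))).congr_deriv ?_
    have hadd := jacSn_add hk x (u + v - x)
    rw [add_sub_cancel] at hadd
    have hpos := (addition_denom_pos hk x (u + v - x)).ne'
    have hid := addition_identity hk x (u + v - x)
    rw [eq_div_iff hpos] at hadd
    rw [jacDn_sq hk, jacDn_sq hk]
    refine mul_right_cancel₀ hpos ?_
    rw [zero_mul]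
    linear_combination (-k ^ 2 * (jacCn x k * jacDn x k * jacSn (u + v - x) k -
      jacSn x k * jacCn (u + v - x) k * jacDn (u + v - x) k)) * hadd - k ^ 2 * hid) u 0
  simp [jacSn_zero hk, jacEps_zero hk] at key
  linarith

theorem jacSn_sub (u v : ℝ) :
    jacSn (u - v) k = (jacSn u k * jacCn v k * jacDn v k - jacSn v k * jacCn u k * jacDn u k) /
      (1 - k ^ 2 * jacSn u k ^ 2 * jacSn v k ^ 2) := by
  rw [sub_eq_add_neg, jacSn_add hk, jacSn_neg hk, jacCn_neg hk, jacDn_neg hk, neg_sq]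
  ring

theorem jacCn_sub (u v : ℝ) :
    jacCn (u - v) k = (jacCn u k * jacCn v k + jacSn u k * jacSn v k * jacDn u k * jacDn v k) /
      (1 - k ^ 2 * jacSn u k ^ 2 * jacSn v k ^ 2) := by
  rw [sub_eq_add_neg, jacCn_add hk, jacSn_neg hk, jacCn_neg hk, jacDn_neg hk, neg_sq]
  ring

theorem jacDn_sub (u v : ℝ) :
    jacDn (u - v) k =
      (jacDn u k * jacDn v k + k ^ 2 * jacSn u k * jacSn v k * jacCn u k * jacCn v k) /
      (1 - k ^ 2 * jacSn u k ^ 2 * jacSn v k ^ 2) := by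
  rw [sub_eq_add_neg, jacDn_add hk, jacSn_neg hk, jacCn_neg hk, jacDn_neg hk, neg_sq]
  ring

theorem jacEps_sub (u v : ℝ) :
    jacEps (u - v) k =
      jacEps u k - jacEps v k + k ^ 2 * jacSn u k * jacSn v k * jacSn (u - v) k := by
  rw [sub_eq_add_neg, jacEps_add hk, jacSn_neg hk, jacEps_neg hk]
  ring

theorem exists_jacSn_sq_eq {a : ℝ} (h0 : 0 ≤ a) (h1 : a ≤ 1) : ∃ τ, jacSn τ k ^ 2 = a := by
  refine ⟨ellF (arcsin √a) k, ?_⟩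
  rw [jacSn, jacAm_ellF hk, sin_arcsin (by linarith [sqrt_nonneg a]) (sqrt_le_one.2 h1), sq_sqrt h0]

theorem jacSn_pos {p : ℝ} (hp : p ∈ Ioo 0 (2 * compK k)) : 0 < jacSn p k := by
  have hmono := strictMono_ellF hk
  refine sin_pos_of_pos_of_lt_pi ?_ ?_
  · rw [← hmono.lt_iff_lt]; simpa [ellF_jacAm hk] using hp.1
  · rw [← hmono.lt_iff_lt]; simpa [ellF_jacAm hk, ellF_pi hk] using hp.2

end jacobi

/-! ### Normal extremals in `N₁` -/

theorem mem_N₁_and_modulus_iff {β c r k : ℝ} (hr : 0 < r) :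
    (β, c, r) ∈ N₁ ∧ modulus β c r = k ↔
      k ∈ Ioo (0 : ℝ) 1 ∧ energy β c r = r * (2 * k ^ 2 - 1) := by
  have h2r : 0 < 2 * r := by linarith
  constructor
  · rintro ⟨⟨-, hE⟩, hm⟩
    simp only [mem_Ioo] at hE
    have h1 : 0 < (energy β c r + r) / (2 * r) := div_pos (by linarith [hE.1]) h2r
    have h2 : (energy β c r + r) / (2 * r) < 1 := by rw [div_lt_one h2r]; linarith [hE.2]
    have h3 : k ^ 2 = (energy β c r + r) / (2 * r) := by rw [← hm, modulus, sq_sqrt h1.le]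
    refine ⟨⟨?_, ?_⟩, ?_⟩
    · rw [← hm]; exact sqrt_pos.2 h1
    · rw [← hm, modulus, sqrt_lt' one_pos]; simpa using h2
    · rw [h3]; field_simp; ring
  · rintro ⟨hk, hE⟩
    have hk2 := sq_lt_one_of_mem ⟨hk.1.le, hk.2⟩
    have hk0 := pow_pos hk.1 2
    refine ⟨⟨hr, ?_⟩, ?_⟩
    · simp only [hE, mem_Ioo]
      constructor <;> nlinarith
    · rw [modulus, hE, show (r * (2 * k ^ 2 - 1) + r) / (2 * r) = k ^ 2 by field_simp; ring]
      exact sqrt_sq hk.1.le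

/-- The angle of the pendulum oscillating with modulus `k` and phase `φ`. -/
noncomputable def oscAngle (k r φ t : ℝ) : ℝ := 2 * arcsin (k * jacSn (√r * t + φ) k)

section oscillation

variable {k r : ℝ} (hk : k ∈ Ioo (0 : ℝ) 1) (hr : 0 < r) (φ t : ℝ)

theorem cos_arcsin_jacSn (k p : ℝ) : cos (arcsin (k * jacSn p k)) = jacDn p k := by
  rw [cos_arcsin, jacDn, mul_pow]

include hk

theorem modulus_mul_jacSn_mem (p : ℝ) : k * jacSn p k ∈ Ioo (-1) 1 := by
  rw [mem_Ioo, ← abs_lt, ← sq_lt_one_iff_abs_lt_one, mul_pow]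
  have hk2 := sq_lt_one_of_mem ⟨hk.1.le, hk.2⟩
  nlinarith [jacSn_sq_le_one (k := k) p, sq_nonneg k, sq_nonneg (jacSn p k)]

theorem sin_arcsin_jacSn (p : ℝ) : sin (arcsin (k * jacSn p k)) = k * jacSn p k :=
  have h := modulus_mul_jacSn_mem hk p
  sin_arcsin h.1.le h.2.le

theorem sin_oscAngle : sin (oscAngle k r φ t) =
    2 * k * jacSn (√r * t + φ) k * jacDn (√r * t + φ) k := by
  rw [oscAngle, sin_two_mul, sin_arcsin_jacSn hk, cos_arcsin_jacSn]; ring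

theorem cos_oscAngle : cos (oscAngle k r φ t) = 1 - 2 * k ^ 2 * jacSn (√r * t + φ) k ^ 2 := by
  rw [oscAngle, cos_two_mul, cos_arcsin_jacSn, jacDn_sq (sq_lt_one_of_mem ⟨hk.1.le, hk.2⟩)]
  ring

omit hk in
theorem hasDerivAt_phase {f : ℝ → ℝ} {f' : ℝ} (h : HasDerivAt f f' (√r * t + φ)) :
    HasDerivAt (fun t => f (√r * t + φ)) (f' * √r) t := by
  refine (h.comp t (((hasDerivAt_id' t).const_mul √r).add_const φ)).congr_deriv ?_
  rw [mul_one]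

theorem hasDerivAt_oscAngle :
    HasDerivAt (oscAngle k r φ) (2 * k * √r * jacCn (√r * t + φ) k) t := by
  have hk2 := sq_lt_one_of_mem ⟨hk.1.le, hk.2⟩
  have h := modulus_mul_jacSn_mem hk (√r * t + φ)
  have h1 := ((hasDerivAt_arcsin h.1.ne' h.2.ne).comp t
    ((hasDerivAt_phase φ t (hasDerivAt_jacSn hk2 _)).const_mul k)).const_mul 2
  refine h1.congr_deriv ?_
  have h2 : √(1 - (k * jacSn (√r * t + φ) k) ^ 2) = jacDn (√r * t + φ) k := by
    rw [jacDn, mul_pow]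
  have h3 := (jacDn_pos hk2 (√r * t + φ)).ne'
  rw [h2]
  field_simp

include hr in
theorem hasDerivAt_oscVelocity :
    HasDerivAt (fun t => 2 * k * √r * jacCn (√r * t + φ) k) (-r * sin (oscAngle k r φ t)) t := by
  have hk2 := sq_lt_one_of_mem ⟨hk.1.le, hk.2⟩
  refine ((hasDerivAt_phase φ t (hasDerivAt_jacCn hk2 _)).const_mul (2 * k * √r)).congr_deriv ?_
  rw [sin_oscAngle hk]
  have := sq_sqrt hr.le
  linear_combination (-2 * k * jacSn (√r * t + φ) k * jacDn (√r * t + φ) k) * this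

include hr in
theorem energy_osc : energy (oscAngle k r φ t) (2 * k * √r * jacCn (√r * t + φ) k) r =
    r * (2 * k ^ 2 - 1) := by
  rw [energy, cos_oscAngle hk, mul_pow, mul_pow, sq_sqrt hr.le, jacCn_sq]
  ring

end oscillation

/-- Two solutions of the pendulum equation with the same initial data coincide. -/
theorem pendulum_unique {r : ℝ} {β c β' c' : ℝ → ℝ} (hβ : ∀ t, HasDerivAt β (c t) t)
    (hc : ∀ t, HasDerivAt c (-r * sin (β t)) t) (hβ' : ∀ t, HasDerivAt β' (c' t) t)
    (hc' : ∀ t, HasDerivAt c' (-r * sin (β' t)) t) (h0 : β 0 = β' 0) (h1 : c 0 = c' 0) (t : ℝ) :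
    β t = β' t ∧ c t = c' t := by
  have hlip : LipschitzWith (max 1 (‖r‖₊ * 1))
      (fun z : ℝ × ℝ => (z.2, -r * sin z.1)) := by
    have hs : LipschitzWith 1 sin := lipschitzWith_of_nnnorm_deriv_le differentiable_sin fun x => by
      rw [Real.deriv_sin, ← NNReal.coe_le_coe]; simpa using abs_cos_le_one x
    have h2 : LipschitzWith (‖r‖₊ * 1) fun z : ℝ × ℝ => -r * sin z.1 := by
      have h3 : LipschitzWith ‖r‖₊ fun x : ℝ => -r * x := LipschitzWith.of_dist_le_mul fun x y => by
        rw [Real.dist_eq, Real.dist_eq, ← mul_sub, abs_mul]; simp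
      exact h3.comp ((mul_one (1 : NNReal)) ▸ hs.comp LipschitzWith.prod_fst)
    exact LipschitzWith.prod_snd.prodMk h2
  have := ODE_solution_unique_univ (v := fun _ z => (z.2, -r * sin z.1)) (s := fun _ => univ)
    (f := fun t => (β t, c t)) (g := fun t => (β' t, c' t)) (t₀ := 0)
    (fun _ => hlip.lipschitzOnWith) (fun t => ⟨(hβ t).prodMk (hc t), trivial⟩)
    (fun t => ⟨(hβ' t).prodMk (hc' t), trivial⟩) (by simp [h0, h1])
  simpa using congrFun this t

/-- Every oscillation of the pendulum with modulus `k` is expressed by Jacobi's functions. -/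
theorem exists_phase {r k : ℝ} {β c : ℝ → ℝ} (hr : 0 < r) (hk : k ∈ Ioo (0 : ℝ) 1)
    (hβ : ∀ t, HasDerivAt β (c t) t) (hc : ∀ t, HasDerivAt c (-r * sin (β t)) t)
    (hE : energy (β 0) (c 0) r = r * (2 * k ^ 2 - 1)) :
    ∃ φ : ℝ, ∃ n : ℤ, ∀ t, β t = oscAngle k r φ t + n * (2 * π) ∧
      c t = 2 * k * √r * jacCn (√r * t + φ) k := by
  have hk2 := sq_lt_one_of_mem ⟨hk.1.le, hk.2⟩
  have hsr := sqrt_pos.2 hr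
  have hsr2 := sq_sqrt hr.le
  -- reduce the initial angle to the interval `(-π, π]`
  obtain ⟨b, hb, n, hn⟩ : ∃ b ∈ Ioc (-π) π, ∃ n : ℤ, β 0 = b + n * (2 * π) := by
    refine ⟨toIocMod two_pi_pos (-π) (β 0), ?_, toIocDiv two_pi_pos (-π) (β 0), ?_⟩
    · have := toIocMod_mem_Ioc two_pi_pos (-π) (β 0)
      rwa [show -π + 2 * π = π by ring] at this
    · have := toIocMod_add_toIocDiv_zsmul two_pi_pos (-π) (β 0)
      rw [zsmul_eq_mul] at this
      exact this.symm
  have hcos : cos (β 0) = 1 - 2 * sin (b / 2) ^ 2 := by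
    rw [hn, cos_add_int_mul_two_pi]
    have := cos_two_mul (b / 2)
    rw [cos_sq', show 2 * (b / 2) = b by ring] at this
    linarith
  have hE' : c 0 ^ 2 / (4 * r) + sin (b / 2) ^ 2 = k ^ 2 := by
    rw [energy, hcos] at hE
    field_simp
    linarith
  -- Energy conservation puts (c/(2k√r), sin(b/2)/k) on the unit circle; its angle ψ is the
  -- amplitude of the initial phase.
  obtain ⟨ψ, hsin, hcosψ⟩ : ∃ ψ, k * sin ψ = sin (b / 2) ∧ 2 * k * √r * cos ψ = c 0 := by
    have hk0 := hk.1.ne'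
    have hXY : (sin (b / 2) / k) ^ 2 = 1 - (c 0 / (2 * k * √r)) ^ 2 := by
      rw [div_pow, div_pow, mul_pow, mul_pow, hsr2]
      field_simp
      field_simp at hE'
      linarith
    have hY : |c 0 / (2 * k * √r)| ≤ 1 := by
      rw [← sq_le_one_iff_abs_le_one]; nlinarith [sq_nonneg (sin (b / 2) / k)]
    have hcY := cos_arccos (abs_le.1 hY).1 (abs_le.1 hY).2
    have hY' : 2 * k * √r * (c 0 / (2 * k * √r)) = c 0 := by field_simp
    have hX' : k * (sin (b / 2) / k) = sin (b / 2) := by field_simp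
    have hsY : sin (arccos (c 0 / (2 * k * √r))) = |sin (b / 2) / k| := by
      rw [sin_arccos, ← hXY, sqrt_sq_eq_abs]
    rcases le_total 0 (sin (b / 2) / k) with h | h
    · exact ⟨_, by rw [hsY, abs_of_nonneg h, hX'], by rw [hcY, hY']⟩
    · exact ⟨-arccos (c 0 / (2 * k * √r)), by rw [sin_neg, hsY, abs_of_nonpos h, neg_neg, hX'],
        by rw [cos_neg, hcY, hY']⟩
  -- Here b ∈ (-π, π] is needed, so that arcsin inverts sin at b/2.
  have hφ0 : oscAngle k r (ellF ψ k) 0 = b := by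
    rw [oscAngle, mul_zero, zero_add, jacSn, jacAm_ellF hk2, hsin,
      arcsin_sin (by linarith [hb.1]) (by linarith [hb.2])]
    ring
  have hc0 : 2 * k * √r * jacCn (√r * 0 + ellF ψ k) k = c 0 := by
    rw [mul_zero, zero_add, jacCn, jacAm_ellF hk2, hcosψ]
  refine ⟨ellF ψ k, n, pendulum_unique hβ hc
    (fun t => (hasDerivAt_oscAngle hk _ t).add_const _) (fun t => ?_) (by rw [hφ0, hn]) hc0.symm⟩
  rw [sin_add_int_mul_two_pi]
  exact hasDerivAt_oscVelocity hk hr _ t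

/-- With A = arcsin(k sn(τ + p)) and B = arcsin(k sn(τ - p)), the cosines are dn and the sines are k
sn, so the left side is cos(A - B). The next two lemmas give cos(A + B) and, up to the factor k,
sin(A + B). -/
theorem dn_mul_dn_add {k : ℝ} (hk : k ^ 2 < 1) (τ p : ℝ) :
    jacDn (τ + p) k * jacDn (τ - p) k + k ^ 2 * jacSn (τ + p) k * jacSn (τ - p) k =
      (1 - 2 * k ^ 2 * jacSn p k ^ 2 + k ^ 2 * jacSn p k ^ 2 * jacSn τ k ^ 2) /
        (1 - k ^ 2 * jacSn τ k ^ 2 * jacSn p k ^ 2) := by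
  have hp := (addition_denom_pos hk τ p).ne'
  rw [jacDn_add hk, jacDn_sub hk, jacSn_add hk, jacSn_sub hk]
  have hd := jacDn_sq hk p
  have hD := jacDn_sq hk τ
  have hc := jacCn_sq p k
  have hC := jacCn_sq τ k
  generalize hQ : 1 - k ^ 2 * jacSn τ k ^ 2 * jacSn p k ^ 2 = Q at *
  generalize jacSn p k = s at *
  generalize jacCn p k = c at *
  generalize jacDn p k = d at *
  generalize jacSn τ k = S at *
  generalize jacCn τ k = C at *
  generalize jacDn τ k = D at *
  field_simp
  ring_nf
  simp only [hd, hD, hc, hC]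
  rw [← hQ]
  ring

theorem dn_mul_dn_sub {k : ℝ} (hk : k ^ 2 < 1) (τ p : ℝ) :
    jacDn (τ + p) k * jacDn (τ - p) k - k ^ 2 * jacSn (τ + p) k * jacSn (τ - p) k =
      (1 - 2 * k ^ 2 * jacSn τ k ^ 2 + k ^ 2 * jacSn p k ^ 2 * jacSn τ k ^ 2) /
        (1 - k ^ 2 * jacSn τ k ^ 2 * jacSn p k ^ 2) := by
  have h1 := dn_mul_dn_add hk p τ
  rw [show p - τ = -(τ - p) by ring, add_comm p τ, jacDn_neg hk, jacSn_neg hk] at h1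
  rw [show 1 - k ^ 2 * jacSn τ k ^ 2 * jacSn p k ^ 2 = 1 - k ^ 2 * jacSn p k ^ 2 * jacSn τ k ^ 2 by
    ring]
  linear_combination h1

theorem sn_mul_dn_add {k : ℝ} (hk : k ^ 2 < 1) (τ p : ℝ) :
    jacSn (τ + p) k * jacDn (τ - p) k + jacSn (τ - p) k * jacDn (τ + p) k =
      2 * jacSn τ k * jacDn τ k * jacCn p k / (1 - k ^ 2 * jacSn τ k ^ 2 * jacSn p k ^ 2) := by
  have hp := (addition_denom_pos hk τ p).ne'
  rw [jacDn_add hk, jacDn_sub hk, jacSn_add hk, jacSn_sub hk]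
  have hd := jacDn_sq hk p
  have hD := jacDn_sq hk τ
  have hc := jacCn_sq p k
  have hC := jacCn_sq τ k
  generalize hQ : 1 - k ^ 2 * jacSn τ k ^ 2 * jacSn p k ^ 2 = Q at *
  generalize jacSn p k = s at *
  generalize jacCn p k = c at *
  generalize jacDn p k = d at *
  generalize jacSn τ k = S at *
  generalize jacCn τ k = C at *
  generalize jacDn τ k = D at *
  field_simp
  rw [← hQ]
  linear_combination 2 * S * D * c * (hd + k ^ 2 * s ^ 2 * hC)

theorem jacCn_sub_sub_jacCn_add {k : ℝ} (hk : k ^ 2 < 1) (τ p : ℝ) :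
    jacCn (τ - p) k - jacCn (τ + p) k =
      2 * jacSn τ k * jacSn p k * jacDn τ k * jacDn p k /
        (1 - k ^ 2 * jacSn τ k ^ 2 * jacSn p k ^ 2) := by
  rw [jacCn_add hk, jacCn_sub hk]; ring

theorem jacEps_add_sub_jacEps_sub {k : ℝ} (hk : k ^ 2 < 1) (τ p : ℝ) :
    jacEps (τ + p) k - jacEps (τ - p) k = 2 * jacEps p k -
      2 * k ^ 2 * jacSn τ k ^ 2 * jacSn p k * jacCn p k * jacDn p k /
        (1 - k ^ 2 * jacSn τ k ^ 2 * jacSn p k ^ 2) := by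
  rw [jacEps_add hk, jacEps_sub hk, jacSn_add hk, jacSn_sub hk]; ring

/-! ### The endpoint conditions in the coordinates (p, τ) -/

theorem coe_eq_pi_iff_cos {θ : ℝ} : (θ : Real.Angle) = (π : Real.Angle) ↔ cos θ = -1 := by
  rw [Real.Angle.angle_eq_iff_two_pi_dvd_sub, cos_eq_neg_one_iff]
  exact exists_congr fun n => ⟨fun h => by linarith, fun h => by linarith⟩

theorem IsNormalExtremal.theta_eq {r : ℝ} {β c θ x y : ℝ → ℝ} (h : IsNormalExtremal r β c θ x y)
    (t : ℝ) : θ t = β t - β 0 := by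
  have := eq_of_hasDerivAt_zero (f := fun t => θ t - β t) (fun t => by
    simpa using (h.deriv_theta t).fun_sub (h.deriv_beta t)) t 0
  simp only [h.theta_zero] at this
  linarith

section phase

variable {r k φ : ℝ} {n : ℤ} {β c θ x y : ℝ → ℝ} (hr : 0 < r) (hk : k ∈ Ioo (0 : ℝ) 1)
  (h : IsNormalExtremal r β c θ x y)
  (hφ : ∀ t, β t = oscAngle k r φ t + n * (2 * π) ∧ c t = 2 * k * √r * jacCn (√r * t + φ) k)
include hk h hφ

/-- Expand sin(β_t - β_0): sin β = 2k sn dn and cos β = 2 dn² - 1 have explicit primitives through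
cn and the epsilon function. -/
theorem IsNormalExtremal.y_eq (t : ℝ) :
    √r / 2 * y t = (1 - 2 * k ^ 2 * jacSn φ k ^ 2) * (k * (jacCn φ k - jacCn (√r * t + φ) k)) -
      2 * k * jacSn φ k * jacDn φ k * (jacEps (√r * t + φ) k - jacEps φ k - √r * t / 2) := by
  have hk2 := sq_lt_one_of_mem ⟨hk.1.le, hk.2⟩
  have hβ0 : β 0 = oscAngle k r φ 0 + n * (2 * π) := (hφ 0).1
  have := eq_of_hasDerivAt_zero (f := fun t => √r / 2 * y t -
    ((1 - 2 * k ^ 2 * jacSn φ k ^ 2) * (k * (jacCn φ k - jacCn (√r * t + φ) k)) -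
      2 * k * jacSn φ k * jacDn φ k * (jacEps (√r * t + φ) k - jacEps φ k - √r * t / 2)))
    (fun t => by
      refine (((h.deriv_y t).const_mul (√r / 2)).fun_sub
        ((((hasDerivAt_phase φ t (hasDerivAt_jacCn hk2 _)).const_sub _).const_mul _ |>.const_mul
          _).fun_sub ((((hasDerivAt_phase φ t (hasDerivAt_jacEps hk2 _)).sub_const _).fun_sub
          (((hasDerivAt_id' t).const_mul √r).div_const 2)).const_mul _))).congr_deriv ?_
      rw [h.theta_eq, hβ0, (hφ t).1, add_sub_add_right_eq_sub, sin_sub, sin_oscAngle hk,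
        sin_oscAngle hk, cos_oscAngle hk, cos_oscAngle hk, jacDn_sq hk2]
      simp only [mul_zero, zero_add]
      ring) t 0
  simp only [h.y_zero, mul_zero, zero_add, zero_div, sub_self] at this
  linarith

theorem IsNormalExtremal.cos_theta (t : ℝ) :
    cos (θ t) = 2 * (jacDn (√r * t + φ) k * jacDn φ k +
      k ^ 2 * jacSn (√r * t + φ) k * jacSn φ k) ^ 2 - 1 := by
  have hk2 := sq_lt_one_of_mem ⟨hk.1.le, hk.2⟩
  rw [h.theta_eq, (hφ 0).1, (hφ t).1, add_sub_add_right_eq_sub, cos_sub, sin_oscAngle hk,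
    sin_oscAngle hk, cos_oscAngle hk, cos_oscAngle hk]
  simp only [mul_zero, zero_add]
  have h1 := jacDn_sq hk2 φ
  have h2 := jacDn_sq hk2 (√r * t + φ)
  generalize jacSn φ k = s at *
  generalize jacDn φ k = d at *
  generalize jacSn (√r * t + φ) k = S at *
  generalize jacDn (√r * t + φ) k = D at *
  linear_combination -2 * D ^ 2 * h1 - 2 * (1 - k ^ 2 * s ^ 2) * h2

omit hk h hφ in
-- Here s, c, d are taken at p and S, D at τ. The hypothesis `h` is the first equation cleared of
-- its denominator; it eliminates τ and leaves `g₁`.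
theorem g₁_identity {k s c d S D X : ℝ} (hd0 : d ≠ 0) (hd : d ^ 2 = 1 - k ^ 2 * s ^ 2)
    (hc : c ^ 2 = 1 - s ^ 2) (hD : D ^ 2 = 1 - k ^ 2 * S ^ 2)
    (h : k ^ 2 * s ^ 2 * S ^ 2 = 2 * k ^ 2 * s ^ 2 - 1) :
    (k * (2 * S * D * c / (2 * d ^ 2)) * (k * (2 * S * s * D * d / (2 * d ^ 2))) +
      (1 - 2 * k ^ 2 * S ^ 2 + k ^ 2 * s ^ 2 * S ^ 2) / (2 * d ^ 2) *
        (X - 2 * k ^ 2 * S ^ 2 * s * c * d / (2 * d ^ 2))) * (s ^ 2 * d ^ 2) =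
    (1 - k ^ 2 + k ^ 2 * c ^ 4) * X + c * s * d * (2 * k ^ 2 * s ^ 2 - 1) := by
  have key : s ^ 2 * (4 * k ^ 2 * S ^ 2 * D ^ 2 * s * c * d +
      2 * d ^ 2 * (1 - 2 * k ^ 2 * S ^ 2 + k ^ 2 * s ^ 2 * S ^ 2) * X -
      (1 - 2 * k ^ 2 * S ^ 2 + k ^ 2 * s ^ 2 * S ^ 2) * (2 * k ^ 2 * S ^ 2 * s * c * d)) =
      4 * d ^ 2 * ((1 - k ^ 2 + k ^ 2 * c ^ 4) * X + c * s * d * (2 * k ^ 2 * s ^ 2 - 1)) := by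
    linear_combination 4 * k ^ 2 * s ^ 2 * S ^ 2 * s * c * d * hD +
      2 * s * c * d * ((1 - k ^ 2 * s ^ 2 * S ^ 2 - (2 * k ^ 2 * s ^ 2 - 1)) * h -
        2 * (2 * k ^ 2 * s ^ 2 - 1) * hd) +
      2 * d ^ 2 * X * ((s ^ 2 - 2) * h - 2 * k ^ 2 * (c ^ 2 + 1 - s ^ 2) * hc)
  have h4 : (4 * d ^ 2) ≠ 0 := by positivity
  refine mul_left_cancel₀ h4 (Eq.trans ?_ key)
  field_simp
  ring

include hr in
theorem IsNormalExtremal.theta_eq_pi_and_y_eq_zero_iff {p τ t : ℝ} (hs : jacSn p k ≠ 0)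
    (ht : √r * t = 2 * p) (hτ : φ = τ - p) :
    ((θ t : Real.Angle) = (π : Real.Angle) ∧ y t = 0) ↔ JacobiSystem k p τ := by
  have hk2 := sq_lt_one_of_mem ⟨hk.1.le, hk.2⟩
  have hk0 := hk.1.ne'
  have hphase : √r * t + φ = τ + p := by rw [ht, hτ]; ring
  have hQ := (addition_denom_pos hk2 τ p).ne'
  have hW := dn_mul_dn_add hk2 τ p
  have hV := dn_mul_dn_sub hk2 τ p
  have hU := sn_mul_dn_add hk2 τ p
  have hsys : JacobiSystem k p τ ↔ (k ^ 2 * jacSn p k ^ 2 * jacSn τ k ^ 2 =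
      2 * k ^ 2 * jacSn p k ^ 2 - 1) ∧ g₁ p k = 0 := by
    rw [JacobiSystem, eq_div_iff (by positivity), mul_comm (jacSn τ k ^ 2)]
  have hθ : (θ t : Real.Angle) = (π : Real.Angle) ↔
      k ^ 2 * jacSn p k ^ 2 * jacSn τ k ^ 2 = 2 * k ^ 2 * jacSn p k ^ 2 - 1 := by
    rw [coe_eq_pi_iff_cos, h.cos_theta hk hφ, hphase, hτ, hW, sub_eq_neg_self, mul_eq_zero,
      or_iff_right two_ne_zero, sq_eq_zero_iff, div_eq_zero_iff, or_iff_left hQ]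
    constructor <;> intro h' <;> linarith
  rw [hsys, hθ]
  refine and_congr_right fun hcond => ?_
  have hd := jacDn_sq hk2 p
  have hd0 := (jacDn_pos hk2 p).ne'
  have hQ2 : 1 - k ^ 2 * jacSn τ k ^ 2 * jacSn p k ^ 2 = 2 * jacDn p k ^ 2 := by
    rw [hd]; linarith
  have hy := h.y_eq hk hφ t
  rw [hphase, hτ, jacCn_sub_sub_jacCn_add hk2, jacEps_add_sub_jacEps_sub hk2, ht, hQ2] at hy
  rw [hQ2] at hU hV
  have hW0 : jacDn (τ + p) k * jacDn (τ - p) k + k ^ 2 * jacSn (τ + p) k * jacSn (τ - p) k = 0 := by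
    rw [hW, div_eq_zero_iff]; left; linarith
  have hd1 := jacDn_sq hk2 (τ + p)
  have hd2 := jacDn_sq hk2 (τ - p)
  -- With A, B the half-angles of the pendulum at the two ends, e = sin(A - B). Since cos(A - B) =
  -- 0, e = ±1, and multiplying by e turns cos 2B and sin 2B into sin(A + B) and -cos(A + B), which
  -- are simple in τ and p.
  obtain ⟨e, he⟩ : ∃ e, e = k * (jacSn (τ + p) k * jacDn (τ - p) k -
    jacSn (τ - p) k * jacDn (τ + p) k) := ⟨_, rfl⟩
  have he2 : e ^ 2 = 1 := by
    rw [he]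
    generalize jacSn (τ + p) k = s1 at *
    generalize jacSn (τ - p) k = s0 at *
    generalize jacDn (τ + p) k = d1 at *
    generalize jacDn (τ - p) k = d0 at *
    linear_combination (-d1 * d0 - k ^ 2 * s1 * s0) * hW0 + (d0 ^ 2 + k ^ 2 * s0 ^ 2) * hd1 + hd2
  have he1 : e * (1 - 2 * k ^ 2 * jacSn (τ - p) k ^ 2) =
      k * (jacSn (τ + p) k * jacDn (τ - p) k + jacSn (τ - p) k * jacDn (τ + p) k) := by
    rw [he]
    generalize jacSn (τ + p) k = s1 at *
    generalize jacSn (τ - p) k = s0 at *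
    generalize jacDn (τ + p) k = d1 at *
    generalize jacDn (τ - p) k = d0 at *
    linear_combination (-2 * k * s0 * d0) * hW0 + 2 * k * s0 * d1 * hd2
  have he3 : e * (2 * k * jacSn (τ - p) k * jacDn (τ - p) k) = -(jacDn (τ + p) k *
      jacDn (τ - p) k - k ^ 2 * jacSn (τ + p) k * jacSn (τ - p) k) := by
    rw [he]
    generalize jacSn (τ + p) k = s1 at *
    generalize jacSn (τ - p) k = s0 at *
    generalize jacDn (τ + p) k = d1 at *
    generalize jacDn (τ - p) k = d0 at *
    linear_combination (1 - 2 * k ^ 2 * s0 ^ 2) * hW0 + 2 * k ^ 2 * s1 * s0 * hd2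
  rw [hU] at he1
  rw [hV] at he3
  have hfin := g₁_identity (X := 2 * jacEps p k - p) hd0 hd (jacCn_sq p k) (jacDn_sq hk2 τ) hcond
  have hg : g₁ p k = e * (√r / 2) * y t * (jacSn p k ^ 2 * jacDn p k ^ 2) := by
    rw [g₁, ← hfin, mul_assoc e, hy, mul_sub e, ← mul_assoc e, ← mul_assoc e, he1, he3]
    ring
  have he0 : e ≠ 0 := by rintro rfl; norm_num at he2
  have hsr := (sqrt_pos.2 hr).ne'
  rw [hg]
  simp [he0, hsr, hs, hd0]

end phase

theorem exists_isNormalExtremal {r k : ℝ} (hr : 0 < r) (hk : k ∈ Ioo (0 : ℝ) 1) (φ : ℝ) :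
    ∃ θ x y : ℝ → ℝ, IsNormalExtremal r (oscAngle k r φ)
      (fun t => 2 * k * √r * jacCn (√r * t + φ) k) θ x y := by
  have hβ := hasDerivAt_oscAngle (r := r) hk φ
  have hc : Continuous (oscAngle k r φ) :=
    continuous_iff_continuousAt.2 fun t => (hβ t).continuousAt
  have hcx : Continuous fun t => cos (oscAngle k r φ t - oscAngle k r φ 0) := by fun_prop
  have hcy : Continuous fun t => sin (oscAngle k r φ t - oscAngle k r φ 0) := by fun_prop
  exact ⟨fun t => oscAngle k r φ t - oscAngle k r φ 0, fun t => ∫ s in (0 : ℝ)..t, _,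
    fun t => ∫ s in (0 : ℝ)..t, _, hβ, hasDerivAt_oscVelocity hk hr φ, fun t => (hβ t).sub_const _,
    fun t => (hcx.integral_hasStrictDerivAt 0 t).hasDerivAt,
    fun t => (hcy.integral_hasStrictDerivAt 0 t).hasDerivAt, sub_self _,
    intervalIntegral.integral_same, intervalIntegral.integral_same⟩

/-- The system `θ_t = π`, `y_t = 0` for extremals in `N₁` is equivalent to the system in the
coordinates `(p, τ)`. -/
theorem extremalSystem_iff {r k p : ℝ} (hr : 0 < r) (hk : k ∈ Ioo (0 : ℝ) 1)
    (hp : p ∈ Ioo 0 (2 * compK k)) : ExtremalSystem r k p ↔ ∃ τ, JacobiSystem k p τ := by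
  have hs := (jacSn_pos (sq_lt_one_of_mem ⟨hk.1.le, hk.2⟩) hp).ne'
  have hsr := (sqrt_pos.2 hr).ne'
  constructor
  · rintro ⟨β, c, θ, x, y, h, hN, hm, t, hpt, hθ, hy⟩
    obtain ⟨-, hE⟩ := (mem_N₁_and_modulus_iff hr).1 ⟨hN, hm⟩
    obtain ⟨φ, n, hφ⟩ := exists_phase hr hk h.deriv_beta h.deriv_c hE
    -- τ is the phase at the midpoint of the arc: the end phases are τ - p and τ + p.
    exact ⟨φ + p, (h.theta_eq_pi_and_y_eq_zero_iff hr hk hφ hs (by linarith)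
      (by ring)).1 ⟨hθ, hy⟩⟩
  · rintro ⟨τ, hτ⟩
    obtain ⟨θ, x, y, h⟩ := exists_isNormalExtremal hr hk (τ - p)
    obtain ⟨hN, hm⟩ := (mem_N₁_and_modulus_iff hr).2 ⟨hk, energy_osc hk hr (τ - p) 0⟩
    have ht : √r * (2 * p / √r) = 2 * p := by field_simp
    refine ⟨_, _, θ, x, y, h, hN, hm, 2 * p / √r, by linarith, ?_⟩
    exact (h.theta_eq_pi_and_y_eq_zero_iff (n := 0) hr hk
      (fun t => ⟨by simp, rfl⟩) hs ht rfl).2 hτ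

/-! ### The systems at and below the first root -/

theorem g₁_ne_zero_of_lt_kStar {k₀ kStar : ℝ} (hk₀ : k₀ ∈ Ioo (1 / √2) 1)
    (hkS : kStar ∈ Ioo (1 / √2) k₀) (hmin : ∀ u ∈ Icc (π / 2) π, 0 ≤ G u kStar) {k p : ℝ}
    (hk : k ∈ Ioo 0 kStar) (hp : p ∈ Ioo 0 (2 * compK k)) : g₁ p k ≠ 0 := fun hg => by
  obtain ⟨-, u, hu, -, hG⟩ := mem_γg₁_iff.1 (⟨⟨hk.1, hk.2.trans (hkS.2.trans hk₀.2)⟩, hp, hg⟩ :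
    ((p, k) : ℝ × ℝ) ∈ γg₁)
  exact (G_pos_of_lt_kStar hk₀ hkS hmin hk ⟨hu.1, hu.2.le⟩).ne' hG

theorem IsFirstRoot.ellF_mem {k v u : ℝ} (h : IsFirstRoot k v u) (hk : k ∈ Ioo (1 / √2) 1) :
    ellF u k ∈ Ioo 0 (2 * compK k) := by
  have hmono := strictMono_ellF (sq_lt_one_of_half_lt hk)
  refine ⟨by simpa using hmono h.mem_pi.1, ?_⟩
  rw [← ellF_pi (sq_lt_one_of_half_lt hk)]
  exact hmono h.mem_pi.2

/-- Minimality needs only g₁ = 0. Solvability in τ holds because 0 < 2k² sin² u - 1 ≤ k² sin² u at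
the first root, so the prescribed sn² τ lies in [0, 1]. -/
theorem IsFirstRoot.isLeast_jacobiSystem {k v u : ℝ} (h : IsFirstRoot k v u)
    (hk : k ∈ Ioo (1 / √2) 1) :
    IsLeast {p : ℝ | p ∈ Ioo 0 (2 * compK k) ∧ ∃ τ, JacobiSystem k p τ} (ellF u k) := by
  have hk2 := sq_lt_one_of_half_lt hk
  have hl := h.isLeast_g₁ hk
  refine ⟨⟨h.ellF_mem hk, ?_⟩, fun p hp => ?_⟩
  · have hs : jacSn (ellF u k) k = sin u := by rw [jacSn, jacAm_ellF hk2]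
    have hsn := h.sn_mem hk
    have hs0 : 0 < sin u := sin_pos_of_pos_of_lt_pi h.mem_pi.1 h.mem_pi.2
    have hden : 0 < k ^ 2 * sin u ^ 2 := mul_pos (pow_pos (pos_of_half_lt hk.1) 2) (pow_pos hs0 2)
    obtain ⟨τ, hτ⟩ := exists_jacSn_sq_eq hk2 (div_nonneg hsn.1.le hden.le)
      ((div_le_one hden).2 (by linarith [one_sub_pos hk2 u]))
    exact ⟨τ, by rw [hs, hτ], hl.1.2⟩
  · obtain ⟨hp, τ, hτ⟩ := hp
    exact hl.2 ⟨hp.1, hτ.2⟩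

end EulerElastica

open EulerElastica

theorem mainTheorem6 :
    ∃ k₀ ∈ Ioo (1 / √2) 1,
      -- `k₀` is the unique root of `2 E(k) - K(k)`
      (∀ k ∈ Ico (0 : ℝ) 1, 2 * EulerElastica.compE k - EulerElastica.compK k = 0 ↔ k = k₀) ∧
      ∃ kStar ∈ Ioo (1 / √2) k₀,
        -- `kStar` is the largest root of `h₁(π - u_{a₁}(k), k)`
        IsGreatest {k : ℝ | k ∈ Ioo (1 / √2) k₀ ∧ ∃ u ∈ Ioo (π / 4) (π / 2),
          EulerElastica.a₁ u k = 0 ∧ EulerElastica.h₁ (π - u) k = 0} kStar ∧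
        -- (1)
        EulerElastica.IsSmoothPlaneCurve EulerElastica.γg₁ ∧
        IsConnected EulerElastica.γg₁ ∧
        -- (2)
        Disjoint EulerElastica.γg₁
          {z : ℝ × ℝ | z.2 ∈ Ioo 0 kStar ∧ z.1 ∈ Ioo 0 (2 * EulerElastica.compK z.2)} ∧
        ∃ u₁ pg₁ : ℝ → ℝ,
          (∀ k ∈ Ico kStar 1, IsLeast {u : ℝ | 0 < u ∧ EulerElastica.h₁ u k = 0} (u₁ k)) ∧
          (∀ k ∈ Ico kStar 1, pg₁ k = EulerElastica.ellF (u₁ k) k) ∧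
          -- (3)
          ContDiffOn ℝ ∞ pg₁ (Ioo kStar 1) ∧
          (∀ k ∈ Ico kStar 1, IsLeast {p : ℝ | 0 < p ∧ EulerElastica.g₁ p k = 0} (pg₁ k)) ∧
          (∀ k ∈ Ico kStar k₀,
            pg₁ k ∈ Ioo (EulerElastica.compK k) (3 / 2 * EulerElastica.compK k)) ∧
          pg₁ k₀ = EulerElastica.compK k₀ ∧
          (∀ k ∈ Ioo k₀ 1,
            pg₁ k ∈ Ioo (1 / 2 * EulerElastica.compK k) (EulerElastica.compK k)) ∧
          -- (4)
          (∀ k ∈ Ico kStar 1,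
            2 * k ^ 2 * EulerElastica.jacSn (pg₁ k) k ^ 2 - 1 ∈ Ioc (0 : ℝ) 1) ∧
          -- (5), for the system in the coordinates `(p, τ)`
          (∀ k ∈ Ioo 0 kStar, ∀ p ∈ Ioo 0 (2 * EulerElastica.compK k), ∀ τ : ℝ,
            ¬ EulerElastica.JacobiSystem k p τ) ∧
          (∀ k ∈ Ico kStar 1,
            IsLeast {p : ℝ | p ∈ Ioo 0 (2 * EulerElastica.compK k) ∧
              ∃ τ : ℝ, EulerElastica.JacobiSystem k p τ} (pg₁ k)) ∧
          -- (5), for the system `θ_t = π`, `y_t = 0` along normal extremals in `N₁`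
          (∀ r : ℝ, 0 < r → ∀ k ∈ Ioo 0 kStar, ∀ p ∈ Ioo 0 (2 * EulerElastica.compK k),
            ¬ EulerElastica.ExtremalSystem r k p) ∧
          (∀ r : ℝ, 0 < r → ∀ k ∈ Ico kStar 1,
            IsLeast {p : ℝ | p ∈ Ioo 0 (2 * EulerElastica.compK k) ∧
              EulerElastica.ExtremalSystem r k p} (pg₁ k)) := by
  obtain ⟨k₀, hk₀, h₀⟩ := exists_k₀
  obtain ⟨kStar, hkS, hroot, hmin⟩ := exists_kStar hk₀ h₀
  have hpi := pi_pos
  have hkS1 : kStar ∈ Ioo (1 / √2) 1 := ⟨hkS.1, hkS.2.trans hk₀.2⟩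
  have hfull : ∀ k ∈ Ico kStar 1, k ∈ Ioo (1 / √2) 1 := fun k hk => ⟨hkS.1.trans_le hk.1, hk.2⟩
  choose! v u₁ hfirst using fun k (hk : k ∈ Ico kStar 1) =>
    exists_isFirstRoot hk₀ hkS hroot hk
  have hanti := strictAntiOn_G (u := π / 2) le_rfl (by linarith)
  have hk₀' : k₀ ∈ Ico (0 : ℝ) 1 := ⟨(pos_of_half_lt hk₀.1).le, hk₀.2⟩
  have hex : ∀ r : ℝ, 0 < r → ∀ k ∈ Ioo (0 : ℝ) 1,
      {p : ℝ | p ∈ Ioo 0 (2 * compK k) ∧ ExtremalSystem r k p} =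
        {p : ℝ | p ∈ Ioo 0 (2 * compK k) ∧ ∃ τ, JacobiSystem k p τ} := fun r hr k hk => by
    ext p
    exact and_congr_right fun hp => extremalSystem_iff hr hk hp
  refine ⟨k₀, hk₀, fun k hk => ?_, kStar, hkS, isGreatest_kStar hk₀ hkS hroot hmin,
    isSmoothPlaneCurve_γg₁, isConnected_γg₁ hkS1 hfirst hk₀ h₀ hkS.2 hmin, ?_,
    u₁, fun k => ellF (u₁ k) k, fun k hk => (hfirst k hk).1.isLeast (hfull k hk),
    fun k _ => rfl, fun k hk => (contDiffAt_ellF_firstRoot hkS1 hfirst hk).contDiffWithinAt,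
    fun k hk => (hfirst k hk).1.isLeast_g₁ (hfull k hk), fun k hk => ?_, ?_, fun k hk => ?_,
    fun k hk => ?_, fun k hk p hp τ hτ => g₁_ne_zero_of_lt_kStar hk₀ hkS hmin hk hp hτ.2,
    fun k hk => (hfirst k hk).1.isLeast_jacobiSystem (hfull k hk), fun r hr k hk p hp hE => ?_,
    fun r hr k hk => ?_⟩
  · rw [← G_pi_div_two]
    exact ⟨fun h => hanti.injOn hk hk₀' (h.trans h₀.symm), fun h => h ▸ h₀⟩
  · rw [Set.disjoint_left]
    exact fun z hz hz' => g₁_ne_zero_of_lt_kStar hk₀ hkS hmin hz'.1 hz'.2 hz.2.2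
  · have hk' : k ∈ Ico kStar 1 := ⟨hk.1, hk.2.trans hk₀.2⟩
    have h := (hfirst k hk').1
    refine ⟨h.lt_of_G_pi_div_two_pos (hfull k hk') ?_, (h.half_lt (hfull k hk')).2⟩
    rw [← h₀]
    exact hanti ⟨(pos_of_half_lt (hfull k hk').1).le, hk'.2⟩ hk₀' hk.2
  · have hk' : k₀ ∈ Ico kStar 1 := ⟨hkS.2.le, hk₀.2⟩
    simp only [(hfirst k₀ hk').1.eq_pi_div_two hk₀ h₀, compK]
  · have hk' : k ∈ Ico kStar 1 := ⟨hkS.2.le.trans hk.1.le, hk.2⟩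
    have h := (hfirst k hk').1
    refine ⟨by linarith [(h.half_lt (hfull k hk')).1],
      h.lt_of_G_pi_div_two_neg (hfull k hk') ?_⟩
    rw [← h₀]
    exact hanti hk₀' ⟨(pos_of_half_lt (hfull k hk').1).le, hk'.2⟩ hk.1
  · rw [jacSn, jacAm_ellF (sq_lt_one_of_half_lt (hfull k hk))]
    exact (hfirst k hk).1.sn_mem (hfull k hk)
  · have hk' : k ∈ Ioo (0 : ℝ) 1 := ⟨hk.1, hk.2.trans hkS1.2⟩
    obtain ⟨τ, hτ⟩ := (extremalSystem_iff hr hk' hp).1 hE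
    exact g₁_ne_zero_of_lt_kStar hk₀ hkS hmin hk hp hτ.2
  · rw [hex r hr k (mem_unit_of_half_lt (hfull k hk))]
    exact (hfirst k hk).1.isLeast_jacobiSystem (hfull k hk)
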